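/- Let $\alpha\in\mathbb R$, $\alpha\neq-1$, and $S_0>0$. Let $V,B:\mathbb R^3\times\mathbb R\to\mathbb R^3$ and $P:\mathbb R^3\times\mathbb R\to\mathbb R$, written as functions of $(y,s)$. Assume that $V\in C^1_sC^2_y(\mathbb R^{3+1})$ (that is, $V$ is $C^1$ in $s$ and $C^2$ in $y$, and $V,\partial_sV,D_yV,D_y^2V$ are continuous on $\mathbb R^3\times\mathbb R$), that $B\in C^1(\mathbb R^{3+1})$, and that $P(\cdot,s)$ is differentiable for every $s$. Assume that on all of $\mathbb R^3\times\mathbb R$ $$ \begin{aligned} &\partial_sV+\tfrac{\alpha}{\alpha+1}V+\tfrac1{\alpha+1}(y\cdot\nabla)V+(V\cdot\nabla)V=(B\cdot\nabla)B-\nabla\bigl(P+\tfrac12|B|^2\bigr),\\ &\partial_sB+\tfrac{\alpha}{\alpha+1}B+\tfrac1{\alpha+1}(y\cdot\nabla)B+(V\cdot\nabla)B=(B\cdot\nabla)V,\\ &\operatorname{div}V=0,\qquad \operatorname{div}B=0, \end{aligned} $$ and that $V$ and $B$ are time periodic with period $S_0$: $V(y,s+S_0)=V(y,s)$ and $B(y,s+S_0)=B(y,s)$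 for all $(y,s)$. Let $G\subset\mathbb R^3$ be an open set containing the origin, and assume: (i) if $\alpha>0$, then $V=0$ on $G\times(0,S_0)$; (ii) if $-1<\alpha\le0$ or $\alpha<-1$, then $V=B=0$ on $G\times(0,S_0)$. Then $V=B=0$ on $\mathbb R^3\times\mathbb R$. -/

import Mathlib

/-- Physical space `ℝ³` with its Euclidean norm and inner product. -/
abbrev E3 : Type := EuclideanSpace ℝ (Fin 3)

noncomputable section

/-- The directional derivative `(u · ∇) W` of a vector field `W` on `ℝ³`, at the point `y`,
in the direction of the vector `u`. -/
def dirDeriv (u : E3) (W : E3 → E3) (y : E3) : E3 :=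
  fderiv ℝ W y u

/-- The divergence `∑ i, ∂ W_i / ∂ y_i` of a vector field `W` on `ℝ³`. -/
def divergence (W : E3 → E3) (y : E3) : ℝ :=
  ∑ i : Fin 3, (fderiv ℝ W y (EuclideanSpace.single i 1)) i

/-- `V ∈ C¹_s C²_y(ℝ³⁺¹)`: the field `V y s` is `C¹` in `s` and `C²` in `y`, and `V`, `∂_s V`,
`D_y V`, `D_y² V` are continuous in `(y, s)` jointly. No bound or decay at infinity is included. -/
structure IsC1sC2y (V : E3 → ℝ → E3) : Prop where
  contDiff_time : ∀ y, ContDiff ℝ 1 (fun s => V y s)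
  contDiff_space : ∀ s, ContDiff ℝ 2 (fun y => V y s)
  continuous_self : Continuous (fun p : E3 × ℝ => V p.1 p.2)
  continuous_time : Continuous (fun p : E3 × ℝ => deriv (fun s => V p.1 s) p.2)
  continuous_space : Continuous (fun p : E3 × ℝ => fderiv ℝ (fun y => V y p.2) p.1)
  continuous_space_two :
    Continuous (fun p : E3 × ℝ => fderiv ℝ (fderiv ℝ (fun y => V y p.2)) p.1)

/-- `(V, B, P)` satisfies the self-similar inviscid MHD system with parameter `α` at every point
`(y, s)` of `ℝ³ × ℝ`. The pressure is only asked to be differentiable in `y`. -/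
structure IsSelfSimilarMHD (α : ℝ) (V B : E3 → ℝ → E3) (P : E3 → ℝ → ℝ) : Prop where
  pressure_differentiable : ∀ s, Differentiable ℝ (fun y => P y s)
  momentum_eq : ∀ y s,
    deriv (fun τ => V y τ) s + (α / (α + 1)) • V y s
        + (1 / (α + 1)) • dirDeriv y (fun z => V z s) y + dirDeriv (V y s) (fun z => V z s) y
      = dirDeriv (B y s) (fun z => B z s) y
        - gradient (fun z => P z s + (1 / 2 : ℝ) * ‖B z s‖ ^ 2) y
  induction_eq : ∀ y s,
    deriv (fun τ => B y τ) s + (α / (α + 1)) • B y s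
        + (1 / (α + 1)) • dirDeriv y (fun z => B z s) y + dirDeriv (V y s) (fun z => B z s) y
      = dirDeriv (B y s) (fun z => V z s) y
  div_V : ∀ y s, divergence (fun z => V z s) y = 0
  div_B : ∀ y s, divergence (fun z => B z s) y = 0

end

open MeasureTheory Set Filter Topology


/-! The vanishing ball can always be enlarged, so the supremum of the radii of balls about the
origin on which both fields vanish is infinite (`exists_larger_ball`, `eq_zero_of_eq_zero_on_ball`).

Suppose `V = B = 0` for `‖y‖ < R`, and write `c' = 1/(α+1)`. By continuity and time periodicity `V`
is small just outside the ball, so `c' y + V` crosses the spheres there transversally: outwards if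
`c' > 0`, inwards if `c' < 0`. `B` solves a linear transport equation along this field. The function
`exp(-K‖y‖²) |B|²` attains its maximum over a closed ball and all times, by periodicity; for large
`K` a positive maximum is impossible, since one could increase the function by moving inwards along
a characteristic (`eq_zero_of_transport`). Hence `B = 0` on a larger ball. There the acceleration of
`V` is a gradient, so the vorticity also solves a linear transport equation
(`hasDerivAt_skewEntry_fderiv`) and vanishes by the same principle. At each time `V` is then
curl-free and divergence-free on a larger ball and zero near the origin; a Carleman inequality gives
`V = 0` (`eq_zero_of_divCurl_free`).

If `α > 0`, the vanishing of `V` near the origin already forces that of `B`, because the damping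
term makes `|B|` grow towards the origin (`magnetic_eq_zero_of_velocity_eq_zero`). -/

/-! ### Weighted inequality for the div-curl system -/

/-- The `j`-th vector of the standard basis of `ℝ³`. -/
noncomputable abbrev stdVec (j : Fin 3) : E3 := EuclideanSpace.single j 1

/-- The `i`-th component of the `j`-th partial derivative of `W`. -/
noncomputable def partialD (W : E3 → E3) (i j : Fin 3) (y : E3) : ℝ := fderiv ℝ W y (stdVec j) i

/-- Integration by parts against the constant 1. Line derivatives suffice, so the fluxes below need
only one partial derivative each. -/
theorem integral_eq_zero_of_hasLineDerivAt {f f' : E3 → ℝ} {v : E3} (hf : Continuous f)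
    (hf' : Continuous f') (hs : HasCompactSupport f)
    (hd : ∀ x, HasLineDerivAt ℝ f (f' x) x v) :
    HasCompactSupport f' ∧ ∫ x, f' x = 0 := by
  have hs' : HasCompactSupport f' := by
    refine hs.mono' fun x hx => ?_
    by_contra hxs
    have h0 : f =ᶠ[nhds x] fun _ => 0 := notMem_tsupport_iff_eventuallyEq.1 hxs
    have h1 : HasLineDerivAt ℝ f 0 x v := by
      have := (hasFDerivAt_const (𝕜 := ℝ) (0 : ℝ) x).congr_of_eventuallyEq h0
      simpa using this.hasLineDerivAt v
    exact hx (HasDerivAt.unique (hd x) h1)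
  refine ⟨hs', ?_⟩
  have h := integral_bilinear_hasLineDerivAt_right_eq_neg_left_of_integrable
    (μ := (volume : Measure E3)) (f := fun _ : E3 => (1 : ℝ)) (f' := fun _ => (0 : ℝ))
    (g := f) (g' := f') (v := v) (B := ContinuousLinearMap.mul ℝ ℝ)
    (by simp) (by simpa using hf'.integrable_of_hasCompactSupport hs')
    (by simpa using hf.integrable_of_hasCompactSupport hs)
    (fun x _ => by
      simpa using (hasFDerivAt_const (𝕜 := ℝ) (1 : ℝ) x).hasLineDerivAt v)
    (fun x _ => hd x)
  simpa using h

theorem hasLineDerivAt_apply {v : E3 → E3} {y : E3} (hv : DifferentiableAt ℝ v y) (i j : Fin 3) :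
    HasLineDerivAt ℝ (fun z => v z i) (partialD v i j y) y (stdVec j) := by
  have h := (((EuclideanSpace.proj i : E3 →L[ℝ] ℝ)).hasFDerivAt.comp y
    hv.hasFDerivAt).hasLineDerivAt (stdVec j)
  exact h

/-- The `i`-th component of the second derivative `∂_k ∂_j W`. -/
noncomputable def partialD₂ (W : E3 → E3) (i j k : Fin 3) (y : E3) : ℝ :=
  fderiv ℝ (fderiv ℝ W) y (stdVec k) (stdVec j) i

theorem partialD₂_symm {W : E3 → E3} (hW : ContDiff ℝ 2 W) (i j k : Fin 3) (y : E3) :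
    partialD₂ W i j k y = partialD₂ W i k j y := by
  have h := (hW.contDiffAt (x := y)).isSymmSndFDerivAt (by simp)
  unfold partialD₂
  rw [h.eq]

theorem hasLineDerivAt_partialD {v : E3 → E3} (hv : ContDiff ℝ 2 v) (y : E3) (i j k : Fin 3) :
    HasLineDerivAt ℝ (partialD v i j) (partialD₂ v i j k y) y (stdVec k) := by
  have h1 : DifferentiableAt ℝ (fderiv ℝ v) y :=
    ((hv.fderiv_right (m := 1) (by norm_num)).differentiable (by norm_num)) y
  have h2 := h1.hasFDerivAt.clm_apply (hasFDerivAt_const (stdVec j) y)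
  have h := (((EuclideanSpace.proj i : E3 →L[ℝ] ℝ)).hasFDerivAt.comp y
    h2).hasLineDerivAt (stdVec k)
  simp only [ContinuousLinearMap.comp_zero, zero_add] at h
  exact h

theorem continuous_partialD {v : E3 → E3} (hv : ContDiff ℝ 1 v) (i j : Fin 3) :
    Continuous (partialD v i j) := by
  have := hv.continuous_fderiv (by norm_num)
  unfold partialD
  fun_prop

theorem continuous_partialD₂ {v : E3 → E3} (hv : ContDiff ℝ 2 v) (i j k : Fin 3) :
    Continuous (partialD₂ v i j k) := by
  have := (hv.fderiv_right (m := 1) (by norm_num)).continuous_fderiv (by norm_num)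
  unfold partialD₂
  fun_prop

theorem hasLineDerivAt_coord (y : E3) (i j : Fin 3) :
    HasLineDerivAt ℝ (fun z : E3 => z i) (if i = j then 1 else 0) y (stdVec j) := by
  have h := ((EuclideanSpace.proj i : E3 →L[ℝ] ℝ)).hasFDerivAt (x := y)
    |>.hasLineDerivAt (stdVec j)
  simpa [Pi.single_apply] using h

theorem HasLineDerivAt.fmul {f g : E3 → ℝ} {f' g' : ℝ} {y v : E3}
    (hf : HasLineDerivAt ℝ f f' y v) (hg : HasLineDerivAt ℝ g g' y v) :
    HasLineDerivAt ℝ (fun z => f z * g z) (f' * g y + f y * g') y v := by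
  have := HasDerivAt.mul hf hg
  simpa using! this

theorem HasLineDerivAt.fsum {ι : Type*} {s : Finset ι} {f : ι → E3 → ℝ} {f' : ι → ℝ} {y v : E3}
    (hf : ∀ i ∈ s, HasLineDerivAt ℝ (f i) (f' i) y v) :
    HasLineDerivAt ℝ (fun z => ∑ i ∈ s, f i z) (∑ i ∈ s, f' i) y v := by
  have := HasDerivAt.fun_sum hf
  simpa using! this

/-- Carleman-type inequality for the div-curl system with a weight `a`. -/
theorem integral_weight_le_integral_divCurl {v : E3 → E3} (hv : ContDiff ℝ 2 v)
    (hc : HasCompactSupport v) {a : E3 → ℝ} {a' : Fin 3 → E3 → ℝ} (ha : Continuous a)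
    (ha' : ∀ j, Continuous (a' j)) (had : ∀ y j, HasLineDerivAt ℝ a (a' j y) y (stdVec j)) :
    ∫ y, (∑ j, y j * a' j y) * (∑ i, v y i ^ 2) ≤
      ∫ y, ∑ i, ((∑ k, y k * (partialD v i k y - partialD v k i y))
        + y i * (∑ k, partialD v k k y) - a y * v y i) ^ 2 := by
  have hvc : Continuous v := hv.continuous
  have hv1 : ContDiff ℝ 1 v := hv.of_le (by norm_num)
  have hD := fun i j => continuous_partialD hv1 i j
  have hH := fun i j k => continuous_partialD₂ hv i j k
  have hdv := fun y i j => hasLineDerivAt_apply ((hv.differentiable (by norm_num)) y) i j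
  have hdD := fun y i j k => hasLineDerivAt_partialD hv y i j k
  set d : E3 → ℝ := fun y => ∑ k, partialD v k k y with hd
  set p : E3 → ℝ := fun y => ∑ k, y k * v y k with hp
  set q : E3 → ℝ := fun y => ∑ k, v y k * v y k with hq
  set e : Fin 3 → E3 → ℝ := fun j y => ∑ k, y k * partialD v j k y with he
  set d' : Fin 3 → E3 → ℝ := fun j y => ∑ k, partialD₂ v k k j y with hd'
  set p' : Fin 3 → E3 → ℝ := fun j y =>
    ∑ k, ((if k = j then 1 else 0) * v y k + y k * partialD v k j y) with hp'
  set q' : Fin 3 → E3 → ℝ := fun j y =>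
    ∑ k, (partialD v k j y * v y k + v y k * partialD v k j y) with hq'
  set e' : Fin 3 → E3 → ℝ := fun j y =>
    ∑ k, ((if k = j then 1 else 0) * partialD v j k y + y k * partialD₂ v j k j y) with he'
  have hdd : ∀ y j, HasLineDerivAt ℝ d (d' j y) y (stdVec j) := fun y j =>
    HasLineDerivAt.fsum fun k _ => hdD y k k j
  have hdp : ∀ y j, HasLineDerivAt ℝ p (p' j y) y (stdVec j) := fun y j =>
    HasLineDerivAt.fsum fun k _ => (hasLineDerivAt_coord y k j).fmul (hdv y k j)
  have hdq : ∀ y j, HasLineDerivAt ℝ q (q' j y) y (stdVec j) := fun y j =>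
    HasLineDerivAt.fsum fun k _ => (hdv y k j).fmul (hdv y k j)
  have hde : ∀ y j, HasLineDerivAt ℝ (e j) (e' j y) y (stdVec j) := fun y j =>
    HasLineDerivAt.fsum fun k _ => (hasLineDerivAt_coord y k j).fmul (hdD y j k j)
  have hcd : Continuous d := by fun_prop
  have hcp : Continuous p := by fun_prop
  have hcq : Continuous q := by fun_prop
  have hce : ∀ j, Continuous (e j) := by intro j; fun_prop
  have hcd' : ∀ j, Continuous (d' j) := by intro j; fun_prop
  have hcp' : ∀ j, Continuous (p' j) := by intro j; fun_prop
  have hcq' : ∀ j, Continuous (q' j) := by intro j; fun_prop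
  have hce' : ∀ j, Continuous (e' j) := by intro j; fun_prop
  -- `Z` is the flux left over when the cross term `2 X · Y` in `hXY` is compared with `(y ·
  -- ∇a)|v|²`; its divergence integrates to zero.
  set Z : Fin 3 → E3 → ℝ := fun j y =>
    d y * (p y * (2 * y j)) + p y * (-2 * e j y) + p y * (-3 * v y j)
      + q y * ((-1/2 : ℝ) * y j) + a y * (q y * (-1 * y j)) with hZ
  set Z' : Fin 3 → E3 → ℝ := fun j y =>
    (d' j y * (p y * (2 * y j)) + d y * (p' j y * (2 * y j) + p y * (2 * 1)))
      + (p' j y * (-2 * e j y) + p y * (-2 * e' j y))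
      + (p' j y * (-3 * v y j) + p y * (-3 * partialD v j j y))
      + (q' j y * ((-1/2 : ℝ) * y j) + q y * ((-1/2 : ℝ) * 1))
      + (a' j y * (q y * (-1 * y j)) + a y * (q' j y * (-1 * y j) + q y * (-1 * 1))) with hZ'
  have hcm : ∀ (c : ℝ) {f : E3 → ℝ} {f' : ℝ} {y w : E3}, HasLineDerivAt ℝ f f' y w →
      HasLineDerivAt ℝ (fun z => c * f z) (c * f') y w := fun c f f' y w h =>
    HasDerivAt.const_mul c h
  have hco : ∀ y j, HasLineDerivAt ℝ (fun z : E3 => z j) 1 y (stdVec j) := fun y j => by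
    simpa using hasLineDerivAt_coord y j j
  have hdZ : ∀ y j, HasLineDerivAt ℝ (Z j) (Z' j y) y (stdVec j) := by
    intro y j
    have h1 := (hdd y j).fmul ((hdp y j).fmul (hcm 2 (hco y j)))
    have h2 := (hdp y j).fmul (hcm (-2) (hde y j))
    have h3 := (hdp y j).fmul (hcm (-3) (hdv y j j))
    have h4 := (hdq y j).fmul (hcm (-1/2) (hco y j))
    have h5 := (had y j).fmul ((hdq y j).fmul (hcm (-1) (hco y j)))
    exact (((HasDerivAt.fun_add h1 h2).fun_add h3).fun_add h4).fun_add h5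
  have hcZ : ∀ j, Continuous (Z j) := by intro j; fun_prop
  have hcZ' : ∀ j, Continuous (Z' j) := by intro j; fun_prop
  have hsD : ∀ i j y, v =ᶠ[nhds y] (fun _ => 0) → partialD v i j y = 0 := by
    intro i j y h
    unfold partialD
    rw [h.fderiv_eq]; simp
  have hsZ : ∀ j, HasCompactSupport (Z j) := by
    intro j
    refine hc.mono' fun y hy => ?_
    by_contra hys
    have h0 : v =ᶠ[nhds y] fun _ => 0 := notMem_tsupport_iff_eventuallyEq.1 hys
    have h1 : v y = 0 := h0.self_of_nhds
    apply hy
    simp [hZ, hp, hq, h1]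
  have key := fun j => integral_eq_zero_of_hasLineDerivAt (hcZ j) (hcZ' j) (hsZ j)
    (fun y => hdZ y j)
  have hint : ∀ j, Integrable (Z' j) := fun j =>
    (hcZ' j).integrable_of_hasCompactSupport (key j).1
  have hsum : ∫ y, ∑ j, Z' j y = 0 := by
    rw [integral_finsetSum _ fun j _ => hint j]
    exact Finset.sum_eq_zero fun j _ => (key j).2
  have hI1 : Integrable fun y => (∑ j, y j * a' j y) * (∑ i, v y i ^ 2) := by
    refine Continuous.integrable_of_hasCompactSupport (by fun_prop) ?_
    refine hc.mono fun y hy => ?_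
    contrapose! hy
    have h1 : v y = 0 := by simpa using hy
    simp [h1]
  have hI2 : Integrable fun y => ∑ i, ((∑ k, y k * (partialD v i k y - partialD v k i y))
        + y i * (∑ k, partialD v k k y) - a y * v y i) ^ 2 := by
    refine Continuous.integrable_of_hasCompactSupport (by fun_prop) ?_
    refine hc.mono' fun y hy => ?_
    by_contra hys
    have h0 : v =ᶠ[nhds y] fun _ => 0 := notMem_tsupport_iff_eventuallyEq.1 hys
    have h1 : v y = 0 := h0.self_of_nhds
    apply hy
    simp [h1, hsD _ _ y h0]
  have hle : ∫ y, ((∑ j, y j * a' j y) * (∑ i, v y i ^ 2) + ∑ j, Z' j y) ≤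
      ∫ y, ∑ i, ((∑ k, y k * (partialD v i k y - partialD v k i y))
        + y i * (∑ k, partialD v k k y) - a y * v y i) ^ 2 := by
    refine integral_mono (hI1.add (integrable_finsetSum _ fun j _ => hint j)) hI2 fun y => ?_
    -- The operator splits as `X + Y`, with `X = y · ∇ + 3/2` skew-adjoint and `Y` symmetric, so `∫
    -- 2 Xv · Yv = ∫ [Y, X]v · v`. The first-order part of `Y` is homogeneous of degree 0 and
    -- commutes with the dilation generator; only `-a` contributes, giving `y · ∇a`.
    have hXY : ∑ i, 2 * ((∑ k, y k * partialD v i k y + 3/2 * v y i) *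
        (y i * (∑ k, partialD v k k y) - ∑ k, y k * partialD v k i y - 3/2 * v y i - a y * v y i))
        = (∑ j, y j * a' j y) * (∑ i, v y i ^ 2) + ∑ j, Z' j y := by
      have s01 := fun i => partialD₂_symm hv i 0 1 y
      have s02 := fun i => partialD₂_symm hv i 0 2 y
      have s12 := fun i => partialD₂_symm hv i 1 2 y
      simp only [hZ', hd, hp, hq, he, hd', hp', hq', he', Fin.sum_univ_three, s01, s02, s12]
      simp
      ring
    simp only
    rw [← hXY]
    refine Finset.sum_le_sum fun i _ => ?_
    have h : ∀ X Y N : ℝ, N = X + Y → 2 * (X * Y) ≤ N ^ 2 := by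
      rintro X Y N rfl; nlinarith [sq_nonneg X, sq_nonneg Y]
    apply h
    simp only [mul_sub, Finset.sum_sub_distrib]
    ring
  rw [integral_add hI1 (integrable_finsetSum _ fun j _ => hint j), hsum, add_zero] at hle
  exact hle


/-! ### Unique continuation for curl-free and divergence-free fields -/

theorem partialD_radial_smul {V : E3 → E3} {k : ℝ → ℝ} {k' : ℝ} {y : E3}
    (hV : DifferentiableAt ℝ V y) (hk : HasDerivAt k k' (‖y‖ ^ 2)) (i j : Fin 3) :
    partialD (fun z => k (‖z‖ ^ 2) • V z) i j y
      = k (‖y‖ ^ 2) * partialD V i j y + 2 * y j * k' * V y i := by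
  have h1 : HasFDerivAt (fun z : E3 => k (‖z‖ ^ 2)) (k' • ((2 : ℕ) • innerSL ℝ y)) y :=
    hk.comp_hasFDerivAt y (hasStrictFDerivAt_norm_sq y).hasFDerivAt
  have h2 := h1.smul hV.hasFDerivAt
  unfold partialD
  rw [HasFDerivAt.fderiv (f := fun z => k (‖z‖ ^ 2) • V z) h2]
  simp [EuclideanSpace.inner_single_right]
  exact Or.inl (by ring)

/-- A cut-off function equal to `1` on `(-∞, a]` and to `0` on `[b, ∞)`. -/
theorem exists_smooth_cutoff {a b : ℝ} (hab : a < b) : ∃ ρ : ℝ → ℝ, ContDiff ℝ 2 ρ ∧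
    (∀ t ≤ a, ρ t = 1) ∧ (∀ t, b ≤ t → ρ t = 0) ∧ (∀ t < a, deriv ρ t = 0) ∧
    (∀ t, b < t → deriv ρ t = 0) := by
  have hba : 0 < b - a := sub_pos.2 hab
  have h1 : ∀ t ≤ a, Real.smoothTransition ((b - t) / (b - a)) = 1 := fun t ht =>
    Real.smoothTransition.one_of_one_le (by rw [le_div_iff₀ hba]; linarith)
  have h0 : ∀ t, b ≤ t → Real.smoothTransition ((b - t) / (b - a)) = 0 := fun t ht =>
    Real.smoothTransition.zero_of_nonpos (div_nonpos_of_nonpos_of_nonneg (by linarith) hba.le)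
  refine ⟨fun t => Real.smoothTransition ((b - t) / (b - a)),
    Real.smoothTransition.contDiff.comp (by fun_prop), h1, h0, fun t ht => ?_, fun t ht => ?_⟩
  · have : (fun t => Real.smoothTransition ((b - t) / (b - a))) =ᶠ[nhds t] fun _ => 1 := by
      filter_upwards [Iio_mem_nhds ht] with x hx using h1 x (le_of_lt hx)
    rw [this.deriv_eq]; simp
  · have : (fun t => Real.smoothTransition ((b - t) / (b - a))) =ᶠ[nhds t] fun _ => 0 := by
      filter_upwards [Ioi_mem_nhds ht] with x hx using h0 x (le_of_lt hx)
    rw [this.deriv_eq]; simp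

theorem sum_sq_eq_norm_sq (y : E3) : ∑ i, y i ^ 2 = ‖y‖ ^ 2 := by
  rw [EuclideanSpace.norm_sq_eq]; simp

/-- The weighted inequality is applied to `k(‖y‖²) V`, where `k` is a cut-off times `exp(τ
exp(-l‖y‖²))`. Since `V` has no curl or divergence on the support of `k`, the operator only
differentiates `k`, and `a` is chosen to cancel the derivative of the exponential, so that only the
derivative of the cut-off remains on the right. -/
theorem carleman_radial {V : E3 → E3} (hV : ContDiff ℝ 2 V) {R' : ℝ}
    (hcurl : ∀ y, ‖y‖ < R' → ∀ i j, partialD V i j y = partialD V j i y)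
    (hdiv : ∀ y, ‖y‖ < R' → ∑ i, partialD V i i y = 0) {ρ : ℝ → ℝ} (hρ : ContDiff ℝ 2 ρ) {b : ℝ}
    (hb : b < R' ^ 2) (hR' : 0 < R') (hρ0 : ∀ t, b ≤ t → ρ t = 0) (l τ : ℝ) :
    ∫ y : E3, (4 * τ * l * ‖y‖ ^ 2 * (l * ‖y‖ ^ 2 - 1) * Real.exp (-l * ‖y‖ ^ 2)) *
        (ρ (‖y‖ ^ 2) * Real.exp (τ * Real.exp (-l * ‖y‖ ^ 2))) ^ 2 * ‖V y‖ ^ 2 ≤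
      ∫ y : E3, (2 * ‖y‖ ^ 2 * deriv ρ (‖y‖ ^ 2) * Real.exp (τ * Real.exp (-l * ‖y‖ ^ 2))) ^ 2
        * ‖V y‖ ^ 2 := by
  set k : ℝ → ℝ := fun t => ρ t * Real.exp (τ * Real.exp (-l * t)) with hk
  set k' : ℝ → ℝ := fun t => (deriv ρ t - ρ t * (τ * l * Real.exp (-l * t))) *
    Real.exp (τ * Real.exp (-l * t)) with hk'
  have hkd : ∀ t, HasDerivAt k (k' t) t := by
    intro t
    have h1 : HasDerivAt ρ (deriv ρ t) t := (hρ.differentiable (by norm_num) t).hasDerivAt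
    have h2 : HasDerivAt (fun t => -l * t) (-l) t := by
      simpa using (hasDerivAt_id t).const_mul (-l)
    have h3 := h1.mul ((h2.exp.const_mul τ).exp)
    convert! h3 using 1
    simp only [hk']; ring
  have hkC : ContDiff ℝ 2 k := by fun_prop
  set v : E3 → E3 := fun z => k (‖z‖ ^ 2) • V z with hv
  have hvC : ContDiff ℝ 2 v := (hkC.comp (contDiff_norm_sq ℝ)).smul hV
  have hvs : HasCompactSupport v := by
    refine HasCompactSupport.of_support_subset_isCompact (isCompact_closedBall (0 : E3) R')
      fun y hy => ?_
    by_contra hyR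
    have h1 : R' < ‖y‖ := by simpa using hyR
    have h2 : b ≤ ‖y‖ ^ 2 := by nlinarith
    exact hy (by simp [hv, hk, hρ0 _ h2])
  -- `A` is `2t` times the logarithmic derivative of `exp(τ exp(-l t))`, which is the cancellation
  -- needed.
  set A : ℝ → ℝ := fun t => -2 * τ * l * t * Real.exp (-l * t) with hA
  set A' : ℝ → ℝ := fun t => -2 * τ * l * (1 - l * t) * Real.exp (-l * t) with hA'
  have hAd : ∀ t, HasDerivAt A (A' t) t := by
    intro t
    have h2 : HasDerivAt (fun t => -l * t) (-l) t := by
      simpa using (hasDerivAt_id t).const_mul (-l)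
    have h3 := ((hasDerivAt_id t).const_mul (-2 * τ * l)).mul h2.exp
    convert! h3 using 1
    simp only [hA', id]; ring
  have had : ∀ (y : E3) j,
      HasLineDerivAt ℝ (fun z : E3 => A (‖z‖ ^ 2)) (2 * y j * A' (‖y‖ ^ 2)) y (stdVec j) := by
    intro y j
    have h := ((hAd (‖y‖ ^ 2)).comp_hasFDerivAt y
      (hasStrictFDerivAt_norm_sq y).hasFDerivAt).hasLineDerivAt (stdVec j)
    convert! h using 1
    simp [EuclideanSpace.inner_single_right]
    ring
  have key := integral_weight_le_integral_divCurl hvC hvs (a := fun z => A (‖z‖ ^ 2))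
    (a' := fun j y => 2 * y j * A' (‖y‖ ^ 2)) (by fun_prop) (by intro j; fun_prop) had
  have hN : ∀ y : E3, ‖y‖ ^ 2 = y 0 ^ 2 + y 1 ^ 2 + y 2 ^ 2 := fun y => by
    rw [← sum_sq_eq_norm_sq, Fin.sum_univ_three]
  convert key using 1
  · congr 1 with y
    rw [sum_sq_eq_norm_sq]
    have h1 : ‖v y‖ ^ 2 = k (‖y‖ ^ 2) ^ 2 * ‖V y‖ ^ 2 := by
      simp only [hv, norm_smul, mul_pow, Real.norm_eq_abs, sq_abs]
    have h2 : ∑ j, y j * (2 * y j * A' (‖y‖ ^ 2)) = 2 * ‖y‖ ^ 2 * A' (‖y‖ ^ 2) := by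
      rw [← sum_sq_eq_norm_sq, Finset.mul_sum, Finset.sum_mul]
      exact Finset.sum_congr rfl fun i _ => by ring
    rw [h1, h2]
    simp only [hA', hk]; ring
  · congr 1 with y
    have hcurl' : ∀ i j, k (‖y‖ ^ 2) * (partialD V i j y - partialD V j i y) = 0 := by
      intro i j
      by_cases hy : ‖y‖ < R'
      · rw [hcurl y hy i j]; simp
      · have h2 : b ≤ ‖y‖ ^ 2 := by push Not at hy; nlinarith
        simp [hk, hρ0 _ h2]
    have hdiv' : k (‖y‖ ^ 2) * ∑ i, partialD V i i y = 0 := by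
      by_cases hy : ‖y‖ < R'
      · rw [hdiv y hy]; simp
      · have h2 : b ≤ ‖y‖ ^ 2 := by push Not at hy; nlinarith
        simp [hk, hρ0 _ h2]
    have hpd : ∀ i j, partialD v i j y = _ := fun i j => partialD_radial_smul
      (hV.differentiable (by norm_num) y) (hkd (‖y‖ ^ 2)) i j
    rw [← sum_sq_eq_norm_sq (V y), Finset.mul_sum]
    refine Finset.sum_congr rfl fun i _ => ?_
    have h1 : (∑ j, y j * (partialD v i j y - partialD v j i y))
        + y i * (∑ j, partialD v j j y) - A (‖y‖ ^ 2) * v y i =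
        (2 * ‖y‖ ^ 2 * k' (‖y‖ ^ 2) - A (‖y‖ ^ 2) * k (‖y‖ ^ 2)) * V y i := by
      have e1 : ∑ j, y j * (partialD v i j y - partialD v j i y) =
          ∑ j, y j * (2 * y j * k' (‖y‖ ^ 2) * V y i - 2 * y i * k' (‖y‖ ^ 2) * V y j) := by
        refine Finset.sum_congr rfl fun j _ => ?_
        rw [hpd, hpd]
        linear_combination y j * hcurl' i j
      have e2 : ∑ j, partialD v j j y = ∑ j, 2 * y j * k' (‖y‖ ^ 2) * V y j := by
        simp only [hpd, Finset.sum_add_distrib, ← Finset.mul_sum, hdiv', zero_add]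
      have e3 : v y i = k (‖y‖ ^ 2) * V y i := by simp [hv]
      rw [e1, e2, e3, show 2 * ‖y‖ ^ 2 * k' (‖y‖ ^ 2) =
        2 * (y 0 ^ 2 + y 1 ^ 2 + y 2 ^ 2) * k' (‖y‖ ^ 2) by rw [hN]]
      simp only [Fin.sum_univ_three]
      ring
    rw [h1]
    simp only [hA, hk, hk']
    ring

/-- Unique continuation from a ball for fields that are curl-free and divergence-free. -/
theorem eq_zero_of_divCurl_free {V : E3 → E3} (hV : ContDiff ℝ 2 V) {R R' : ℝ} (hR : 0 < R)
    (hcurl : ∀ y, ‖y‖ < R' → ∀ i j, partialD V i j y = partialD V j i y)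
    (hdiv : ∀ y, ‖y‖ < R' → ∑ i, partialD V i i y = 0) (h0 : ∀ y, ‖y‖ < R → V y = 0)
    {y₀ : E3} (hy₀ : ‖y₀‖ < R') : V y₀ = 0 := by
  by_contra hne
  obtain ⟨r, hr1, hr2⟩ := exists_between hy₀
  have hr0 : 0 < r := (norm_nonneg _).trans_lt hr1
  have hR'0 : 0 < R' := hr0.trans hr2
  obtain ⟨b, hb1, hb2⟩ := exists_between (pow_lt_pow_left₀ hr2 hr0.le two_ne_zero)
  obtain ⟨ρ, hρ, hρ1, hρ0, hρ1', hρ0'⟩ := exists_smooth_cutoff hb1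
  -- This `l` makes the Carleman weight, which has the sign of `l‖y‖² - 1`, positive wherever `V`
  -- may be nonzero.
  set l : ℝ := 2 / R ^ 2 with hl
  have hl0 : 0 < l := by positivity
  have hlR : ∀ t, R ^ 2 ≤ t → 2 ≤ l * t := by
    intro t ht
    rw [hl, div_mul_eq_mul_div, le_div_iff₀ (by positivity)]; linarith
  set c : ℝ := Real.exp (-l * r ^ 2) with hc
  have hρc : Continuous (deriv ρ) := hρ.continuous_deriv (by norm_num)
  have hVc : Continuous V := hV.continuous
  set W : E3 → ℝ := fun y => (2 * ‖y‖ ^ 2 * deriv ρ (‖y‖ ^ 2)) ^ 2 * ‖V y‖ ^ 2 with hW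
  -- A continuous substitute for `‖V‖²` restricted to the ball of radius `r`.
  set u : E3 → ℝ := fun y => max 0 (1 - ‖y‖ ^ 2 / r ^ 2) * ‖V y‖ ^ 2 with hu
  have hWc : Continuous W := by fun_prop
  have huc : Continuous u := by fun_prop
  have hlarge : ∀ y : E3, y ∉ Metric.closedBall (0 : E3) R' → b < ‖y‖ ^ 2 := by
    intro y hy
    have h1 : R' < ‖y‖ := by simpa using hy
    nlinarith
  have hsupp : ∀ f : E3 → ℝ, (∀ y, b < ‖y‖ ^ 2 → f y = 0) → HasCompactSupport f := by
    intro f hf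
    refine HasCompactSupport.of_support_subset_isCompact (isCompact_closedBall (0 : E3) R')
      fun y hy => ?_
    by_contra hyR
    exact hy (hf y (hlarge y hyR))
  have hus : HasCompactSupport u := by
    refine hsupp u fun y hy => ?_
    have : 1 - ‖y‖ ^ 2 / r ^ 2 ≤ 0 := by
      rw [sub_nonpos, le_div_iff₀ (by positivity)]; linarith
    simp [hu, this]
  have hWs : HasCompactSupport W := hsupp W fun y hy => by simp [hW, hρ0' _ hy]
  have hupos : 0 < ∫ y, u y := by
    refine huc.integral_pos_of_hasCompactSupport_nonneg_nonzero (x := y₀) hus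
      (fun y => by simp only [hu, Pi.zero_apply]; positivity) ?_
    have h1 : 0 < 1 - ‖y₀‖ ^ 2 / r ^ 2 := by
      rw [sub_pos, div_lt_one (by positivity)]
      exact pow_lt_pow_left₀ hr1 (norm_nonneg _) two_ne_zero
    simp only [hu]
    have h2 : 0 < ‖V y₀‖ := norm_pos_iff.2 hne
    have h3 : 0 < max 0 (1 - ‖y₀‖ ^ 2 / r ^ 2) := lt_max_of_lt_right h1
    positivity
  have hest : ∀ τ : ℝ, 0 < τ → τ * (8 * c) * ∫ y, u y ≤ ∫ y, W y := by
    intro τ hτ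
    -- `K` is the value of the exponential weight on `‖y‖ = r`. The weight decreases with `‖y‖`: it
    -- is at least `K` where `u` lives and at most `K` where the cut-off varies, so `K²` cancels.
    set K : ℝ := Real.exp (τ * c) with hK
    have hK0 : 0 < K := Real.exp_pos _
    have key := carleman_radial hV hcurl hdiv hρ hb2 hR'0 hρ0 l τ
    have hright : ∫ y : E3, (2 * ‖y‖ ^ 2 * deriv ρ (‖y‖ ^ 2) *
        Real.exp (τ * Real.exp (-l * ‖y‖ ^ 2))) ^ 2 * ‖V y‖ ^ 2 ≤ ∫ y, K ^ 2 * W y := by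
      refine integral_mono ?_ ((hWc.integrable_of_hasCompactSupport hWs).const_mul _) fun y => ?_
      · exact Continuous.integrable_of_hasCompactSupport (by fun_prop)
          (hsupp _ fun y hy => by simp [hρ0' _ hy])
      · rcases lt_or_ge (‖y‖ ^ 2) (r ^ 2) with h | h
        · simp [hW, hρ1' _ h]
        · have h1 : Real.exp (τ * Real.exp (-l * ‖y‖ ^ 2)) ≤ K := by
            rw [hK, hc]
            refine Real.exp_le_exp.2 (mul_le_mul_of_nonneg_left (Real.exp_le_exp.2 ?_) hτ.le)
            nlinarith
          have h2 : Real.exp (τ * Real.exp (-l * ‖y‖ ^ 2)) ^ 2 ≤ K ^ 2 := by gcongr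
          have h3 : 0 ≤ W y := by simp only [hW]; positivity
          calc _ = Real.exp (τ * Real.exp (-l * ‖y‖ ^ 2)) ^ 2 * W y := by simp only [hW]; ring
            _ ≤ _ := by gcongr
    have hleft : ∫ y, K ^ 2 * (τ * (8 * c) * u y) ≤
        ∫ y : E3, (4 * τ * l * ‖y‖ ^ 2 * (l * ‖y‖ ^ 2 - 1) * Real.exp (-l * ‖y‖ ^ 2)) *
        (ρ (‖y‖ ^ 2) * Real.exp (τ * Real.exp (-l * ‖y‖ ^ 2))) ^ 2 * ‖V y‖ ^ 2 := by
      refine integral_mono (((huc.integrable_of_hasCompactSupport hus).const_mul _).const_mul _)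
        ?_ fun y => ?_
      · have := hρ.continuous
        exact Continuous.integrable_of_hasCompactSupport (by fun_prop)
          (hsupp _ fun y hy => by simp [hρ0 _ hy.le])
      · rcases lt_or_ge (‖y‖) R with h | h
        · simp [hu, h0 y h]
        · have hy2 : 2 ≤ l * ‖y‖ ^ 2 := hlR _ (by gcongr)
          simp only
          rcases lt_or_ge (r ^ 2) (‖y‖ ^ 2) with h' | h'
          · have : 1 - ‖y‖ ^ 2 / r ^ 2 ≤ 0 := by
              rw [sub_nonpos, le_div_iff₀ (by positivity)]; linarith
            simp only [hu, max_eq_left this, zero_mul, mul_zero]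
            have : 0 ≤ l * ‖y‖ ^ 2 - 1 := by linarith
            positivity
          · rw [hρ1 _ h', one_mul]
            have h1 : c ≤ Real.exp (-l * ‖y‖ ^ 2) := by
              rw [hc]; exact Real.exp_le_exp.2 (by nlinarith)
            have h2 : K ^ 2 ≤ Real.exp (τ * Real.exp (-l * ‖y‖ ^ 2)) ^ 2 := by
              rw [hK]; gcongr
            have h3 : u y ≤ ‖V y‖ ^ 2 := by
              simp only [hu]
              refine mul_le_of_le_one_left (by positivity) (max_le zero_le_one ?_)
              have : 0 ≤ ‖y‖ ^ 2 / r ^ 2 := by positivity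
              linarith
            have h4 : 8 ≤ 4 * (l * ‖y‖ ^ 2) * (l * ‖y‖ ^ 2 - 1) := by nlinarith
            have hc0 : 0 < c := Real.exp_pos _
            calc K ^ 2 * (τ * (8 * c) * u y)
                ≤ Real.exp (τ * Real.exp (-l * ‖y‖ ^ 2)) ^ 2 *
                  (τ * ((4 * (l * ‖y‖ ^ 2) * (l * ‖y‖ ^ 2 - 1)) * Real.exp (-l * ‖y‖ ^ 2)) *
                    ‖V y‖ ^ 2) := by gcongr
              _ = _ := by ring
    have h := hleft.trans (key.trans hright)
    rw [integral_const_mul, integral_const_mul, integral_const_mul] at h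
    exact le_of_mul_le_mul_left h (by positivity)
  have hc0 : 0 < c := Real.exp_pos _
  have hW0 : 0 ≤ ∫ y, W y := integral_nonneg fun y => by simp only [hW, Pi.zero_apply]; positivity
  have hJ : 0 < 8 * c * ∫ y, u y := by positivity
  -- This `τ` makes the left side equal to `∫ W + 1`.
  have h := hest (((∫ y, W y) + 1) / (8 * c * ∫ y, u y)) ?_
  · have h2 : ((∫ y, W y) + 1) / (8 * c * ∫ y, u y) * (8 * c) * ∫ y, u y = (∫ y, W y) + 1 := by
      rw [mul_assoc, div_mul_cancel₀ _ hJ.ne']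
    linarith
  · positivity


/-! ### Maximum principle for time-periodic transport -/

theorem exists_max_of_periodic {h : E3 → ℝ → ℝ} (hc : Continuous fun p : E3 × ℝ => h p.1 p.2)
    {T : ℝ} (hT : 0 < T) (hper : ∀ y s, h y (s + T) = h y s) {K : Set E3} (hK : IsCompact K)
    (hne : K.Nonempty) : ∃ y ∈ K, ∃ s, ∀ z ∈ K, ∀ t, h z t ≤ h y s := by
  obtain ⟨⟨y, s⟩, ⟨hy, hs⟩, hmax⟩ := (hK.prod (isCompact_Icc (a := (0 : ℝ)) (b := T))).exists_isMaxOn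
    (hne.prod (nonempty_Icc.2 hT.le)) hc.continuousOn
  refine ⟨y, hy, s, fun z hz t => ?_⟩
  have hp : Function.Periodic (h z) T := hper z
  obtain ⟨t', ht', he⟩ := hp.exists_mem_Ico₀ hT t
  rw [he]
  exact hmax (show (z, t') ∈ K ×ˢ Icc 0 T from ⟨hz, ht'.1, ht'.2.le⟩)

/-- Maximum principle for transport with inward-pointing characteristics. -/
theorem nonpos_of_transport {h : E3 → ℝ → ℝ} (hc : Continuous fun p : E3 × ℝ => h p.1 p.2)
    {T : ℝ} (hT : 0 < T) (hper : ∀ y s, h y (s + T) = h y s) {K : Set E3} (hK : IsCompact K)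
    {σ : ℝ}
    (hdir : ∀ y ∈ K, ∀ s, 0 < h y s → ∃ b : E3, (∀ᶠ t in 𝓝[>] (0 : ℝ), y - (σ * t) • b ∈ K) ∧
      ∃ d, HasDerivAt (fun t => h (y + t • b) (s + t)) d 0 ∧ σ * d < 0)
    {y : E3} (hy : y ∈ K) (s : ℝ) : h y s ≤ 0 := by
  obtain ⟨z, hz, r, hmax⟩ := exists_max_of_periodic hc hT hper hK ⟨y, hy⟩
  refine (hmax y hy s).trans ?_
  by_contra! hpos
  obtain ⟨b, hb, d, hd, hneg⟩ := hdir z hz r hpos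
  -- Along the inward ray, time is rescaled by the same factor `-σ`; this allows either sign of `σ`.
  have h1 : HasDerivAt (fun t : ℝ => h (z + (-σ * t) • b) (r + (-σ * t))) (d * (-σ)) 0 := by
    have h2 : HasDerivAt (fun t : ℝ => -σ * t) (-σ) 0 := by
      simpa using (hasDerivAt_id (0 : ℝ)).const_mul (-σ)
    have h3 : HasDerivAt (fun t => h (z + t • b) (r + t)) d (-σ * 0) := by simpa using hd
    exact h3.comp (0 : ℝ) h2
  have h2 := (hasDerivWithinAt_iff_tendsto_slope' (by simp)).1 (h1.hasDerivWithinAt (s := Ioi 0))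
  have h3 : d * (-σ) ≤ 0 := by
    refine le_of_tendsto h2 ?_
    filter_upwards [hb, self_mem_nhdsWithin] with t ht ht0
    have ht0' : 0 < t := ht0
    rw [slope_def_field]
    refine div_nonpos_of_nonpos_of_nonneg ?_ (by simpa using ht0'.le)
    have := hmax _ ht (r + -σ * t)
    have e : z - (σ * t) • b = z + (-σ * t) • b := by rw [neg_mul, neg_smul, sub_eq_add_neg]
    rw [e] at this
    simpa using this
  linarith

/-- Zero data on a ball propagates to a concentric larger ball along characteristics that cross the
annulus transversally. -/
theorem eq_zero_of_transport {ι : Type*} [Fintype ι] {f : ι → E3 → ℝ → ℝ} {b : E3 → ℝ → E3}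
    (hc : ∀ i, Continuous fun p : E3 × ℝ => f i p.1 p.2)
    {T : ℝ} (hT : 0 < T) (hper : ∀ i y s, f i y (s + T) = f i y s) {R R' C m σ : ℝ}
    (hm : 0 < m) (hC : 0 ≤ C) (h0 : ∀ i y s, ‖y‖ ≤ R → f i y s = 0)
    (hb : ∀ y s, R < ‖y‖ → ‖y‖ ≤ R' → m ≤ σ * inner ℝ y (b y s))
    {f' : ι → E3 → ℝ → ℝ}
    (hd : ∀ i y s, R < ‖y‖ → ‖y‖ ≤ R' →
      HasDerivAt (fun t => f i (y + t • b y s) (s + t)) (f' i y s) 0)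
    (hf' : ∀ i y s, R < ‖y‖ → ‖y‖ ≤ R' → |f' i y s| ≤ C * ∑ j, |f j y s|)
    (i : ι) {y : E3} (hy : ‖y‖ ≤ R') (s : ℝ) : f i y s = 0 := by
  set g : E3 → ℝ → ℝ := fun y s => ∑ i, f i y s ^ 2 with hg
  set n : ℝ := (Fintype.card ι : ℝ)
  -- The decay of the weight along characteristics, at rate at least `2 K m`, exceeds by 1 the
  -- possible growth `2 C n |σ|` of `g`.
  set K : ℝ := (2 * C * n * |σ| + 1) / (2 * m) with hK
  have hKm : 2 * K * m = 2 * C * n * |σ| + 1 := by rw [hK]; field_simp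
  have hK0 : 0 < K := by positivity
  have hle : Real.exp (-K * ‖y‖ ^ 2) * g y s ≤ 0 := by
    refine nonpos_of_transport (h := fun y s => Real.exp (-K * ‖y‖ ^ 2) * g y s)
      (σ := σ) (K := Metric.closedBall 0 R') (by fun_prop) hT
      (fun y s => by simp only [hg, hper]) (isCompact_closedBall _ _) ?_ (by simpa using hy) s
    intro y hyR s hpos
    have hyR' : ‖y‖ ≤ R' := by simpa using hyR
    have hgpos : 0 < g y s := (pos_iff_pos_of_mul_pos hpos).1 (Real.exp_pos _)
    have hyR1 : R < ‖y‖ := by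
      by_contra! hle
      simp [hg, h0 _ y s hle] at hgpos
    have hby := hb y s hyR1 hyR'
    have hnorm : HasDerivAt (fun t : ℝ => ‖y + t • b y s‖ ^ 2) (2 * inner ℝ y (b y s)) 0 := by
      have h1 : HasDerivAt (fun t : ℝ => y + t • b y s) (b y s) 0 := by
        simpa using ((hasDerivAt_id (0 : ℝ)).smul_const (b y s)).const_add y
      simpa using h1.norm_sq
    have hprod := ((hnorm.const_mul (-K)).exp).fun_mul
        (HasDerivAt.fun_sum fun i (_ : i ∈ Finset.univ) => (hd i y s hyR1 hyR').fun_pow 2)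
    refine ⟨b y s, ?_, _, hprod, ?_⟩
    · have h2 : HasDerivAt (fun t : ℝ => ‖y - (σ * t) • b y s‖ ^ 2)
          (2 * inner ℝ y (b y s) * (-σ)) 0 := by
        have h2 : HasDerivAt (fun t : ℝ => -σ * t) (-σ) 0 := by
          simpa using (hasDerivAt_id (0 : ℝ)).const_mul (-σ)
        have h3 : HasDerivAt (fun t : ℝ => ‖y + t • b y s‖ ^ 2) (2 * inner ℝ y (b y s)) (-σ * 0) := by
          simpa using hnorm
        have h4 := h3.comp (0 : ℝ) h2
        convert! h4 using 1
        ext t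
        simp [sub_eq_add_neg]
      have h5 := (hasDerivWithinAt_iff_tendsto_slope' (by simp)).1 (h2.hasDerivWithinAt (s := Ioi 0))
      filter_upwards [h5.eventually_lt_const (show 2 * inner ℝ y (b y s) * (-σ) < 0 by linarith),
        self_mem_nhdsWithin] with t ht ht0
      have ht0' : 0 < t := ht0
      rw [slope_def_field, div_neg_iff] at ht
      have h6 : ‖y - (σ * t) • b y s‖ ^ 2 < ‖y‖ ^ 2 := by
        rcases ht with ht | ht
        · simp at ht; linarith
        · simpa using ht.1
      have h7 := lt_of_pow_lt_pow_left₀ 2 (norm_nonneg _) h6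
      simpa using h7.le.trans hyR'
    · simp only [zero_smul, add_zero]
      set S : ℝ := ∑ i, |f i y s| with hS
      set D : ℝ := ∑ i, ((2 : ℕ) : ℝ) * f i y s ^ (2 - 1) * f' i y s with hD
      have hDb : |D| ≤ 2 * C * n * g y s := by
        have h1 : |D| ≤ 2 * C * S ^ 2 := by
          calc |D| ≤ ∑ i, |((2 : ℕ) : ℝ) * f i y s ^ (2 - 1) * f' i y s| :=
                Finset.abs_sum_le_sum_abs _ _
            _ ≤ ∑ i, 2 * (C * S) * |f i y s| := by
                refine Finset.sum_le_sum fun i _ => ?_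
                have := hf' i y s hyR1 hyR'
                simp only [abs_mul]
                norm_num
                nlinarith [abs_nonneg (f i y s)]
            _ = _ := by rw [← Finset.mul_sum]; ring
        have h2 : S ^ 2 ≤ n * g y s := by
          have := sq_sum_le_card_mul_sum_sq (s := Finset.univ) (f := fun i => |f i y s|)
          simpa [hS, hg, n] using this
        nlinarith
      have hσD : σ * D ≤ 2 * C * n * |σ| * g y s := by
        calc σ * D ≤ |σ| * |D| := by rw [← abs_mul]; exact le_abs_self _
          _ ≤ |σ| * (2 * C * n * g y s) := by gcongr
          _ = _ := by ring
      have hexp := Real.exp_pos (-K * ‖y‖ ^ 2)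
      have hneg : σ * D - 2 * K * (σ * inner ℝ y (b y s)) * g y s < 0 := by
        have : 2 * K * m * g y s ≤ 2 * K * (σ * inner ℝ y (b y s)) * g y s := by gcongr
        rw [hKm] at this
        linarith
      have := mul_neg_of_pos_of_neg hexp hneg
      have e : σ * (Real.exp (-K * ‖y‖ ^ 2) * (-K * (2 * inner ℝ y (b y s))) * g y s +
          Real.exp (-K * ‖y‖ ^ 2) * D) = Real.exp (-K * ‖y‖ ^ 2) *
          (σ * D - 2 * K * (σ * inner ℝ y (b y s)) * g y s) := by ring
      rw [← e] at this
      exact this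
  have hg0 : g y s ≤ 0 := by
    have := Real.exp_pos (-K * ‖y‖ ^ 2)
    by_contra! h
    have := mul_pos this h
    linarith
  have h1 : f i y s ^ 2 ≤ g y s := Finset.single_le_sum (f := fun i => f i y s ^ 2)
    (fun i _ => sq_nonneg _) (Finset.mem_univ i)
  nlinarith [sq_nonneg (f i y s)]


/-! ### Vorticity equation with minimal regularity -/

theorem hasFDerivAt_intervalIntegral_of_continuous {G : Type*} [NormedAddCommGroup G]
    [NormedSpace ℝ G] {F : E3 → ℝ → G} {F' : E3 → ℝ → E3 →L[ℝ] G}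
    {U : Set E3} (hU : IsOpen U) (hF : ∀ x ∈ U, Continuous (F x))
    (hF' : Continuous fun p : E3 × ℝ => F' p.1 p.2)
    (hd : ∀ x ∈ U, ∀ t, HasFDerivAt (fun z => F z t) (F' x t) x) (a b : ℝ) {x : E3} (hx : x ∈ U) :
    HasFDerivAt (fun z => ∫ t in a..b, F z t) (∫ t in a..b, F' x t) x := by
  obtain ⟨r, hr, hrU⟩ := Metric.isOpen_iff.1 hU x hx
  have hcpt : IsCompact (Metric.closedBall x (r / 2) ×ˢ uIcc a b) :=
    (isCompact_closedBall _ _).prod isCompact_uIcc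
  obtain ⟨C, hC⟩ := hcpt.exists_bound_of_continuousOn hF'.continuousOn
  refine intervalIntegral.hasFDerivAt_integral_of_dominated_of_fderiv_le (bound := fun _ => C)
    (s := Metric.ball x (r / 2)) (Metric.ball_mem_nhds _ (by positivity)) ?_
    ((hF x hx).intervalIntegrable _ _) ?_ ?_ (by simp) ?_
  · filter_upwards [hU.mem_nhds hx] with z hz using (hF z hz).aestronglyMeasurable
  · have : Continuous fun t => F' x t := hF'.comp (by fun_prop : Continuous fun t : ℝ => (x, t))
    exact this.aestronglyMeasurable
  · refine Eventually.of_forall fun t ht z hz => hC (z, t) ⟨Metric.ball_subset_closedBall hz, ?_⟩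
    exact uIoc_subset_uIcc ht
  · refine Eventually.of_forall fun t _ z hz => hd z (hrU ?_) t
    exact Metric.ball_subset_ball (by linarith) hz

/-- The derivative of a time-averaged gradient field is symmetric. No regularity of the potential
in time is required. -/
theorem fderiv_integral_gradient_symm {q : E3 → ℝ → ℝ} {k : E3 → ℝ → E3}
    (hk : Continuous fun p : E3 × ℝ => k p.1 p.2) {r : ℝ}
    (hq : ∀ x, ‖x‖ < r → ∀ t, HasFDerivAt (fun z => q z t) (innerSL ℝ (k x t)) x) (a b : ℝ)
    {x : E3} (hx : ‖x‖ < r) {W' : E3 →L[ℝ] E3}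
    (hW : HasFDerivAt (fun z => ∫ t in a..b, k z t) W' x) (u w : E3) :
    inner ℝ (W' u) w = inner ℝ (W' w) u := by
  have hU : IsOpen (Metric.ball (0 : E3) r) := Metric.isOpen_ball
  have hball : ∀ z : E3, z ∈ Metric.ball (0 : E3) r ↔ ‖z‖ < r := by simp
  -- The potential is arbitrary in time up to a function of `t`. Subtracting its value at the origin
  -- leaves the line integral of `k`, which is continuous in time.
  have hQ : ∀ z ∈ Metric.ball (0 : E3) r, Continuous fun t => q z t - q 0 t := by
    intro z hz
    have h1 : ∀ t, ∫ θ in (0 : ℝ)..1, inner ℝ (k (θ • z) t) z = q z t - q 0 t := by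
      intro t
      have h2 : ∀ θ ∈ uIcc (0 : ℝ) 1,
          HasDerivAt (fun θ : ℝ => q (θ • z) t) (inner ℝ (k (θ • z) t) z) θ := by
        intro θ hθ
        rw [uIcc_of_le zero_le_one] at hθ
        have h3 : ‖θ • z‖ < r := by
          rw [norm_smul, Real.norm_eq_abs, abs_of_nonneg hθ.1]
          have := (hball z).1 hz
          nlinarith [norm_nonneg z, hθ.2]
        have h4 : HasDerivAt (fun θ : ℝ => θ • z) z θ := by
          simpa using (hasDerivAt_id θ).smul_const z
        simpa using! (hq _ h3 t).comp_hasDerivAt θ h4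
      have hc : Continuous fun θ : ℝ => inner ℝ (k (θ • z) t) z := by
        have : Continuous fun θ : ℝ => k (θ • z) t :=
          hk.comp (by fun_prop : Continuous fun θ : ℝ => (θ • z, t))
        fun_prop
      rw [intervalIntegral.integral_eq_sub_of_hasDerivAt h2 (hc.intervalIntegrable _ _)]
      simp
    simp_rw [← h1]
    refine intervalIntegral.continuous_parametric_intervalIntegral_of_continuous' ?_ 0 1
    have : Continuous fun p : ℝ × ℝ => k (p.2 • z) p.1 :=
      hk.comp (by fun_prop : Continuous fun p : ℝ × ℝ => (p.2 • z, p.1))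
    exact this.inner continuous_const
  have hk' : Continuous fun p : E3 × ℝ => innerSL ℝ (k p.1 p.2) := by fun_prop
  have hΦ : ∀ z ∈ Metric.ball (0 : E3) r,
      HasFDerivAt (fun z => ∫ t in a..b, (q z t - q 0 t)) (innerSL ℝ (∫ t in a..b, k z t)) z := by
    intro z hz
    have h := hasFDerivAt_intervalIntegral_of_continuous (F := fun z t => q z t - q 0 t)
      (F' := fun z t => innerSL ℝ (k z t)) hU hQ hk'
      (fun z hz t => (hq z ((hball z).1 hz) t).sub_const _) a b hz
    have hkz : Continuous fun t => k z t := hk.comp (by fun_prop : Continuous fun t : ℝ => (z, t))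
    have e := ContinuousLinearMap.intervalIntegral_comp_comm (μ := volume) (a := a) (b := b)
      (innerSL ℝ (E := E3)) (hkz.intervalIntegrable a b)
    rw [← e]
    exact h
  have h2 : HasFDerivAt (fun z => innerSL ℝ (∫ t in a..b, k z t)) ((innerSL ℝ).comp W') x :=
    (innerSL ℝ (E := E3)).hasFDerivAt.comp x hW
  have := second_derivative_symmetric_of_eventually
    (f := fun z => ∫ t in a..b, (q z t - q 0 t)) (f'' := (innerSL ℝ).comp W')
    (by filter_upwards [hU.mem_nhds ((hball x).2 hx)] with z hz using hΦ z hz) h2 u w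
  simpa using this

/-- The `(i, j)` entry of the antisymmetric part of an operator (without the factor `1/2`). -/
noncomputable def skewEntry (i j : Fin 3) : (E3 →L[ℝ] E3) →L[ℝ] ℝ :=
  (EuclideanSpace.proj i : E3 →L[ℝ] ℝ).comp (ContinuousLinearMap.apply ℝ E3 (stdVec j))
    - (EuclideanSpace.proj j : E3 →L[ℝ] ℝ).comp (ContinuousLinearMap.apply ℝ E3 (stdVec i))

theorem skewEntry_apply (i j : Fin 3) (L : E3 →L[ℝ] E3) :
    skewEntry i j L = L (stdVec j) i - L (stdVec i) j := by
  simp [skewEntry]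

theorem clm_apply_eq_sum (L : E3 →L[ℝ] E3) (u : E3) (i : Fin 3) :
    L u i = ∑ k, u k * L (stdVec k) i := by
  have h : u = ∑ k, u k • stdVec k := by
    ext j
    fin_cases j <;> simp [Fin.sum_univ_three, stdVec]
  conv_lhs => rw [h]
  simp

/-- This is `L² - (L²)ᵀ = (L - Lᵀ)L + Lᵀ(L - Lᵀ)`; it makes the stretching term linear in the
vorticity. -/
theorem skewEntry_comp_self (i j : Fin 3) (L : E3 →L[ℝ] E3) :
    skewEntry i j (L.comp L) = ∑ k, (skewEntry i k L * L (stdVec j) k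
      + L (stdVec i) k * skewEntry k j L) := by
  simp only [skewEntry_apply, ContinuousLinearMap.comp_apply]
  rw [clm_apply_eq_sum L (L (stdVec j)) i, clm_apply_eq_sum L (L (stdVec i)) j,
    ← Finset.sum_sub_distrib]
  exact Finset.sum_congr rfl fun k _ => by ring

theorem abs_apply_stdVec_le (L : E3 →L[ℝ] E3) (i j : Fin 3) : |L (stdVec j) i| ≤ ‖L‖ := by
  have h1 := PiLp.norm_apply_le (L (stdVec j)) i
  have h2 := L.le_opNorm (stdVec j)
  simp at h1 h2
  exact h1.trans h2

theorem abs_skewEntry_comp_self_le (i j : Fin 3) (L : E3 →L[ℝ] E3) :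
    |skewEntry i j (L.comp L)| ≤ 2 * ‖L‖ * ∑ p : Fin 3 × Fin 3, |skewEntry p.1 p.2 L| := by
  rw [skewEntry_comp_self]
  have h1 : ∑ k, |skewEntry i k L| ≤ ∑ p : Fin 3 × Fin 3, |skewEntry p.1 p.2 L| := by
    rw [Fintype.sum_prod_type]
    exact Finset.single_le_sum (f := fun i => ∑ k, |skewEntry i k L|)
      (fun i _ => Finset.sum_nonneg fun _ _ => abs_nonneg _) (Finset.mem_univ i)
  have h2 : ∑ k, |skewEntry k j L| ≤ ∑ p : Fin 3 × Fin 3, |skewEntry p.1 p.2 L| := by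
    rw [Fintype.sum_prod_type_right]
    exact Finset.single_le_sum (f := fun j => ∑ k, |skewEntry k j L|)
      (fun i _ => Finset.sum_nonneg fun _ _ => abs_nonneg _) (Finset.mem_univ j)
  calc _ ≤ ∑ k, |skewEntry i k L * L (stdVec j) k + L (stdVec i) k * skewEntry k j L| :=
        Finset.abs_sum_le_sum_abs _ _
    _ ≤ ∑ k, (‖L‖ * |skewEntry i k L| + ‖L‖ * |skewEntry k j L|) := by
        refine Finset.sum_le_sum fun k _ => (abs_add_le _ _).trans ?_
        rw [abs_mul, abs_mul, mul_comm |skewEntry i k L|]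
        gcongr <;> exact abs_apply_stdVec_le _ _ _
    _ ≤ _ := by
        rw [Finset.sum_add_distrib, ← Finset.mul_sum, ← Finset.mul_sum]
        nlinarith [norm_nonneg L]



/-- The convective part `c W + c' (y · ∇) W + (W · ∇) W` of the self-similar equations. -/
noncomputable def convection (c c' : ℝ) (W : E3 → E3) (y : E3) : E3 :=
  c • W y + c' • fderiv ℝ W y y + fderiv ℝ W y (W y)

/-- The derivative of `convection c c' W`. -/
noncomputable def convectionDeriv (c c' : ℝ) (W : E3 → E3) (y : E3) : E3 →L[ℝ] E3 :=
  (c + c') • fderiv ℝ W y + fderiv ℝ (fderiv ℝ W) y (c' • y + W y)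
    + (fderiv ℝ W y).comp (fderiv ℝ W y)

theorem hasFDerivAt_convection (c c' : ℝ) {W : E3 → E3} (hW : ContDiff ℝ 2 W) (y : E3) :
    HasFDerivAt (convection c c' W) (convectionDeriv c c' W y) y := by
  have hdM : HasFDerivAt (fderiv ℝ W) (fderiv ℝ (fderiv ℝ W) y) y :=
    (((hW.fderiv_right (m := 1) (by norm_num)).differentiable (by norm_num)) y).hasFDerivAt
  have hdV : HasFDerivAt W (fderiv ℝ W y) y :=
    ((hW.differentiable (by norm_num)) y).hasFDerivAt
  have hsymm : ∀ u w, fderiv ℝ (fderiv ℝ W) y u w = fderiv ℝ (fderiv ℝ W) y w u :=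
    (hW.contDiffAt (x := y)).isSymmSndFDerivAt (by simp)
  have h1 := (hdV.const_smul c).add ((hdM.clm_apply (hasFDerivAt_id y)).const_smul c')
  have h2 := h1.add (hdM.clm_apply hdV)
  refine h2.congr_fderiv ?_
  ext u : 1
  simp only [convectionDeriv, add_apply, smul_apply,
    ContinuousLinearMap.comp_apply, ContinuousLinearMap.flip_apply, map_add, map_smul,
    hsymm u, id, ContinuousLinearMap.id_apply]
  module

theorem continuous_convection (c c' : ℝ) {V : E3 → ℝ → E3} (hV : IsC1sC2y V) :
    Continuous fun p : E3 × ℝ => convection c c' (fun z => V z p.2) p.1 := by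
  have hcV := hV.continuous_self
  have hcM := hV.continuous_space
  unfold convection
  fun_prop

theorem continuous_convectionDeriv (c c' : ℝ) {V : E3 → ℝ → E3} (hV : IsC1sC2y V) :
    Continuous fun p : E3 × ℝ => convectionDeriv c c' (fun z => V z p.2) p.1 := by
  have hcV := hV.continuous_self
  have hcM := hV.continuous_space
  have hcD := hV.continuous_space_two
  unfold convectionDeriv
  exact (((hcM.const_smul (c + c')).add (hcD.clm_apply (by fun_prop))).add (hcM.clm_comp hcM))

theorem skewEntry_eq_zero_of_symm {L : E3 →L[ℝ] E3} (h : ∀ u w, inner ℝ (L u) w = inner ℝ (L w) u)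
    (i j : Fin 3) : skewEntry i j L = 0 := by
  have := h (stdVec j) (stdVec i)
  rw [skewEntry_apply, sub_eq_zero]
  simpa [EuclideanSpace.inner_single_right] using this

/-- The field `∂_s V` need not be differentiable in `y`, so the curl of the momentum equation cannot
be taken pointwise. Integrating in time first replaces `∂_s V` by a difference of values of `V`, and
the time-averaged gradient still has a symmetric derivative. -/
theorem skewEntry_fderiv_eq_sub_integral {V : E3 → ℝ → E3} (hV : IsC1sC2y V) {q : E3 → ℝ → ℝ}
    {c c' r : ℝ} (hq : ∀ x, ‖x‖ < r → ∀ t, HasFDerivAt (fun z => q z t)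
      (innerSL ℝ (-(deriv (fun τ => V x τ) t + convection c c' (fun z => V z t) x))) x)
    {y : E3} (hy : ‖y‖ < r) (s : ℝ) (i j : Fin 3) :
    skewEntry i j (fderiv ℝ (fun z => V z s) y) = skewEntry i j (fderiv ℝ (fun z => V z 0) y)
      - ∫ t in (0 : ℝ)..s, skewEntry i j (convectionDeriv c c' (fun z => V z t) y) := by
  have hcT := hV.continuous_time
  have hcF := continuous_convection c c' hV
  have hcF' := continuous_convectionDeriv c c' hV
  have hpair : ∀ x : E3, Continuous fun t : ℝ => (x, t) := fun x => by fun_prop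
  have hcTx : ∀ x, Continuous fun t => deriv (fun τ => V x τ) t := fun x => hcT.comp (hpair x)
  have hcFx : ∀ x, Continuous fun t => convection c c' (fun z => V z t) x :=
    fun x => hcF.comp (hpair x)
  have hcF'x : ∀ x, Continuous fun t => convectionDeriv c c' (fun z => V z t) x :=
    fun x => (hcF'.comp (hpair x) :)
  have hdV : ∀ s, HasFDerivAt (fun z => V z s) (fderiv ℝ (fun z => V z s) y) y := fun s =>
    (((hV.contDiff_space s).differentiable (by norm_num)) y).hasFDerivAt
  have hint : ∀ z, ∫ t in (0 : ℝ)..s,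
      -(deriv (fun τ => V z τ) t + convection c c' (fun z => V z t) z) =
        -(V z s - V z 0) - ∫ t in (0 : ℝ)..s, convection c c' (fun z => V z t) z := by
    intro z
    have h1 : ∫ t in (0 : ℝ)..s, deriv (fun τ => V z τ) t = V z s - V z 0 :=
      intervalIntegral.integral_eq_sub_of_hasDerivAt
        (fun t _ => (((hV.contDiff_time z).differentiable (by norm_num)) t).hasDerivAt)
        ((hcTx z).intervalIntegrable _ _)
    rw [intervalIntegral.integral_neg, intervalIntegral.integral_add
      ((hcTx z).intervalIntegrable _ _) ((hcFx z).intervalIntegrable _ _), h1]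
    abel
  have hW : HasFDerivAt (fun z => ∫ t in (0 : ℝ)..s,
      -(deriv (fun τ => V z τ) t + convection c c' (fun z => V z t) z))
      (-(fderiv ℝ (fun z => V z s) y - fderiv ℝ (fun z => V z 0) y)
        - ∫ t in (0 : ℝ)..s, convectionDeriv c c' (fun z => V z t) y) y := by
    simp only [hint]
    exact (((hdV s).sub (hdV 0)).neg).sub (hasFDerivAt_intervalIntegral_of_continuous
      (F := fun z t => convection c c' (fun z => V z t) z)
      (F' := fun z t => convectionDeriv c c' (fun z => V z t) z)
      isOpen_univ (fun z _ => hcFx z) hcF'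
      (fun z _ t => hasFDerivAt_convection c c' (hV.contDiff_space t) z) 0 s (mem_univ y))
  have hs := fderiv_integral_gradient_symm (q := q)
    (k := fun z t => -(deriv (fun τ => V z τ) t + convection c c' (fun z => V z t) z))
    (hcT.add hcF).neg (r := r) hq 0 s hy hW
  have hα := skewEntry_eq_zero_of_symm hs i j
  rw [map_sub, map_neg, map_sub, ← ContinuousLinearMap.intervalIntegral_comp_comm _
    ((hcF'x y).intervalIntegrable _ _)] at hα
  linarith

/-- A function with continuous partial derivatives is differentiable along space-time lines. -/
theorem hasDerivAt_line_of_partials {f : E3 → ℝ → ℝ} {f₁ : E3 → ℝ → E3 →L[ℝ] ℝ} {f₂ : E3 → ℝ → ℝ}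
    {r : ℝ} (h₁ : ∀ y, ‖y‖ < r → ∀ s, HasFDerivAt (fun z => f z s) (f₁ y s) y)
    (h₂ : ∀ y, ‖y‖ < r → ∀ s, HasDerivAt (fun t => f y t) (f₂ y s) s)
    (hc₁ : Continuous fun p : E3 × ℝ => f₁ p.1 p.2) (hc₂ : Continuous fun p : E3 × ℝ => f₂ p.1 p.2)
    {y : E3} (hy : ‖y‖ < r) (s : ℝ) (b : E3) :
    HasDerivAt (fun t : ℝ => f (y + t • b) (s + t)) (f₁ y s b + f₂ y s) 0 := by
  have hnhds : ∀ᶠ p : E3 × ℝ in 𝓝 (y, s), ‖p.1‖ < r :=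
    (continuous_fst.norm.continuousAt (x := (y, s))).eventually_lt_const hy
  have hc : Continuous fun x : ℝ => ContinuousLinearMap.toSpanSingleton ℝ x :=
    (ContinuousLinearMap.toSpanSingletonCLE (𝕜 := ℝ) (E := ℝ)).continuous
  have hjoint := (hasStrictFDerivAt_uncurry_coprod (𝕜 := ℝ) (u := (y, s))
    (f := f) (f₁ := f₁) (f₂ := fun y s => ContinuousLinearMap.toSpanSingleton ℝ (f₂ y s))
    (hnhds.mono fun p hp => h₁ p.1 hp p.2) (hnhds.mono fun p hp => (h₂ p.1 hp p.2).hasFDerivAt)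
    hc₁.continuousAt (hc.comp hc₂).continuousAt).hasFDerivAt
  have hline : HasDerivAt (fun t : ℝ => (y + t • b, s + t)) (b, (1 : ℝ)) 0 := by
    refine HasDerivAt.prodMk ?_ ?_
    · simpa using ((hasDerivAt_id (0 : ℝ)).smul_const b).const_add y
    · simpa using (hasDerivAt_id (0 : ℝ)).const_add s
  have hfin := HasFDerivAt.comp_hasDerivAt_of_eq (0 : ℝ) hjoint hline (by simp)
  simpa [Function.HasUncurry.uncurry, Function.comp_def] using! hfin

/-- Evolution of the vorticity matrix, along a frozen characteristic direction, wherever the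
acceleration is a gradient. -/
theorem hasDerivAt_skewEntry_fderiv {V : E3 → ℝ → E3} (hV : IsC1sC2y V) {q : E3 → ℝ → ℝ}
    {c c' r : ℝ} (hq : ∀ x, ‖x‖ < r → ∀ t, HasFDerivAt (fun z => q z t)
      (innerSL ℝ (-(deriv (fun τ => V x τ) t + convection c c' (fun z => V z t) x))) x)
    {y : E3} (hy : ‖y‖ < r) (s : ℝ) (i j : Fin 3) :
    HasDerivAt (fun t => skewEntry i j
        (fderiv ℝ (fun z => V z (s + t)) (y + t • (c' • y + V y s))))
      (-((c + c') * skewEntry i j (fderiv ℝ (fun z => V z s) y)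
        + skewEntry i j ((fderiv ℝ (fun z => V z s) y).comp (fderiv ℝ (fun z => V z s) y)))) 0 := by
  have hcF' := continuous_convectionDeriv c c' hV
  have hcα : ∀ y, Continuous fun t =>
      skewEntry i j (convectionDeriv c c' (fun z => V z t) y) := fun y =>
    (skewEntry i j).continuous.comp ((hcF'.comp (by fun_prop : Continuous fun t : ℝ => (y, t))) :)
  have hdt : ∀ y, ‖y‖ < r → ∀ s,
      HasDerivAt (fun s => skewEntry i j (fderiv ℝ (fun z => V z s) y))
        (-skewEntry i j (convectionDeriv c c' (fun z => V z s) y)) s := by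
    intro y hy s
    have h1 := (intervalIntegral.integral_hasDerivAt_right ((hcα y).intervalIntegrable 0 s)
      ((hcα y).stronglyMeasurableAtFilter volume _) (hcα y).continuousAt).const_sub
        (skewEntry i j (fderiv ℝ (fun z => V z 0) y))
    exact h1.congr_of_eventuallyEq
      (Eventually.of_forall fun t => skewEntry_fderiv_eq_sub_integral hV hq hy t i j)
  have hdM : ∀ y s, HasFDerivAt (fderiv ℝ (fun z => V z s))
      (fderiv ℝ (fderiv ℝ (fun z => V z s)) y) y := fun y s =>
    ((((hV.contDiff_space s).fderiv_right (m := 1) (by norm_num)).differentiable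
      (by norm_num)) y).hasFDerivAt
  have hfin := hasDerivAt_line_of_partials
    (f := fun y s => skewEntry i j (fderiv ℝ (fun z => V z s) y))
    (f₁ := fun y s => (skewEntry i j).comp (fderiv ℝ (fderiv ℝ (fun z => V z s)) y))
    (f₂ := fun y s => -skewEntry i j (convectionDeriv c c' (fun z => V z s) y))
    (fun y _ s => (skewEntry i j).hasFDerivAt.comp y (hdM y s)) hdt
    (continuous_const.clm_comp hV.continuous_space_two)
    (((skewEntry i j).continuous.comp hcF').neg) hy s (c' • y + V y s)
  -- The second derivatives of `V` in the direction `c' y + V` cancel between the space and time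
  -- parts.
  refine hfin.congr_deriv ?_
  simp only [convectionDeriv, map_add, map_smul, ContinuousLinearMap.comp_apply, smul_eq_mul]
  ring


/-! ### Enlarging the ball of vanishing -/

theorem eq_zero_of_ball {G : Type*} [NormedAddCommGroup G] {f : E3 → G} (hf : Continuous f) {R : ℝ}
    (hR : 0 < R) (h : ∀ y, ‖y‖ < R → f y = 0) {y : E3} (hy : ‖y‖ ≤ R) : f y = 0 := by
  have h1 : EqOn f (fun _ => 0) (Metric.ball 0 R) := fun z hz => h z (by simpa using hz)
  refine h1.closure hf continuous_const ?_
  rw [closure_ball _ hR.ne']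
  simpa using hy

theorem exists_bound_of_periodic {G : Type*} [NormedAddCommGroup G] {f : E3 → ℝ → G}
    (hc : Continuous fun p : E3 × ℝ => f p.1 p.2) {T : ℝ} (hT : 0 < T)
    (hper : ∀ y s, f y (s + T) = f y s) (r : ℝ) :
    ∃ L, 0 ≤ L ∧ ∀ y, ‖y‖ ≤ r → ∀ s, ‖f y s‖ ≤ L := by
  obtain ⟨L, hL⟩ := ((isCompact_closedBall (0 : E3) r).prod
    (isCompact_Icc (a := (0 : ℝ)) (b := T))).exists_bound_of_continuousOn hc.continuousOn
  refine ⟨max L 0, le_max_right _ _, fun y hy s => ?_⟩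
  have hp : Function.Periodic (f y) T := hper y
  obtain ⟨t, ht, he⟩ := hp.exists_mem_Ico₀ hT s
  rw [he]
  exact (hL (y, t) ⟨by simpa using hy, ht.1, ht.2.le⟩).trans (le_max_left _ _)

/-- A time-periodic function that is small on a closed ball is small on a larger ball. -/
theorem exists_radius_lt_of_periodic {f : E3 → ℝ → ℝ} (hc : Continuous fun p : E3 × ℝ => f p.1 p.2)
    {T : ℝ} (hT : 0 < T) (hper : ∀ y s, f y (s + T) = f y s) {R δ : ℝ}
    (h : ∀ y, ‖y‖ ≤ R → ∀ s, f y s < δ) : ∃ R' > R, ∀ y, ‖y‖ ≤ R' → ∀ s, f y s < δ := by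
  set K : Set (E3 × ℝ) := (Metric.closedBall 0 (R + 1) ×ˢ Icc 0 T) ∩ {p | δ ≤ f p.1 p.2} with hK
  have hKc : IsCompact K := ((isCompact_closedBall _ _).prod isCompact_Icc).inter_right
    (isClosed_le continuous_const hc)
  have hred : ∀ ρ ≤ R + 1, (∀ p ∈ K, ρ < ‖p.1‖) → ∀ y, ‖y‖ ≤ ρ → ∀ s, f y s < δ := by
    intro ρ hρ hp y hy s
    have hpy : Function.Periodic (f y) T := hper y
    obtain ⟨t, ht, he⟩ := hpy.exists_mem_Ico₀ hT s
    by_contra! hcon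
    rw [he] at hcon
    have := hp (y, t) ⟨⟨by simpa using hy.trans hρ, ht.1, ht.2.le⟩, hcon⟩
    exact absurd hy (not_le.2 this)
  rcases K.eq_empty_or_nonempty with hE | hne
  · exact ⟨R + 1, by linarith, hred _ le_rfl (by simp [hE])⟩
  · obtain ⟨p, hp, hmin⟩ := hKc.exists_isMinOn hne
      (f := fun p : E3 × ℝ => ‖p.1‖) (by fun_prop)
    have hpR : R < ‖p.1‖ := by
      by_contra! hle
      exact absurd (h p.1 hle p.2) (not_lt.2 hp.2)
    have hpR1 : ‖p.1‖ ≤ R + 1 := by simpa using hp.1.1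
    obtain ⟨ρ, h1, h2⟩ := exists_between hpR
    exact ⟨ρ, h1, hred ρ (h2.le.trans hpR1) fun z hz => h2.trans_le (hmin hz)⟩

theorem norm_le_sum_abs (x : E3) : ‖x‖ ≤ ∑ j, |x j| := by
  have h : x = ∑ k, x k • stdVec k := by
    ext j
    fin_cases j <;> simp [Fin.sum_univ_three, stdVec]
  conv_lhs => rw [h]
  refine (norm_sum_le _ _).trans (Finset.sum_le_sum fun j _ => ?_)
  simp [norm_smul]

theorem hasDerivAt_line_of_contDiff {B : E3 → ℝ → E3}
    (hB : ContDiff ℝ 1 fun p : E3 × ℝ => B p.1 p.2) (y : E3) (s : ℝ) (b : E3) :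
    HasDerivAt (fun t : ℝ => B (y + t • b) (s + t))
      (deriv (fun τ => B y τ) s + fderiv ℝ (fun z => B z s) y b) 0 := by
  have hJ := (hB.differentiable (by norm_num) (y, s)).hasFDerivAt
  set J := fderiv ℝ (fun p : E3 × ℝ => B p.1 p.2) (y, s)
  have h1 : HasFDerivAt (fun z => B z s) (J.comp (ContinuousLinearMap.inl ℝ E3 ℝ)) y :=
    hJ.comp (f := fun z => (z, s)) y (hasFDerivAt_prodMk_left y s)
  have h2 : HasDerivAt (fun τ => B y τ) (J (0, 1)) s := by
    have : HasDerivAt (fun τ : ℝ => (y, τ)) ((0 : E3), (1 : ℝ)) s :=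
      (hasDerivAt_const s y).prodMk (hasDerivAt_id s)
    exact hJ.comp_hasDerivAt (f := fun τ => (y, τ)) s this
  have hline : HasDerivAt (fun t : ℝ => (y + t • b, s + t)) (b, (1 : ℝ)) 0 := by
    refine HasDerivAt.prodMk ?_ ?_
    · simpa using ((hasDerivAt_id (0 : ℝ)).smul_const b).const_add y
    · simpa using (hasDerivAt_id (0 : ℝ)).const_add s
  have h3 := HasFDerivAt.comp_hasDerivAt_of_eq (0 : ℝ) hJ hline (by simp)
  rw [h1.fderiv, h2.deriv]
  refine (h3 : HasDerivAt (fun t : ℝ => B (y + t • b) (s + t)) _ 0).congr_deriv ?_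
  rw [ContinuousLinearMap.comp_apply, ← map_add]
  simp

section

variable {α S₀ : ℝ} {V B : E3 → ℝ → E3} {P : E3 → ℝ → ℝ}

/-- The transport equation for the magnetic field along a frozen characteristic direction. -/
theorem IsSelfSimilarMHD.hasDerivAt_magnetic (hB : ContDiff ℝ 1 (fun p : E3 × ℝ => B p.1 p.2))
    (hsol : IsSelfSimilarMHD α V B P) (y : E3) (s : ℝ) :
    HasDerivAt (fun t : ℝ => B (y + t • ((1 / (α + 1)) • y + V y s)) (s + t))
      (fderiv ℝ (fun z => V z s) y (B y s) - (α / (α + 1)) • B y s) 0 := by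
  refine (hasDerivAt_line_of_contDiff hB y s _).congr_deriv ?_
  have h := hsol.induction_eq y s
  simp only [dirDeriv] at h
  rw [← h, map_add, map_smul]
  abel

theorem IsSelfSimilarMHD.hasFDerivAt_totalPressure
    (hB : ContDiff ℝ 1 (fun p : E3 × ℝ => B p.1 p.2)) (hsol : IsSelfSimilarMHD α V B P)
    {y : E3} {s : ℝ} (h0 : B y s = 0) :
    HasFDerivAt (fun z => P z s + (1 / 2 : ℝ) * ‖B z s‖ ^ 2)
      (innerSL ℝ (-(deriv (fun τ => V y τ) s
        + convection (α / (α + 1)) (1 / (α + 1)) (fun z => V z s) y))) y := by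
  have hBs : Differentiable ℝ fun z => B z s :=
    (hB.differentiable (by norm_num)).comp (by fun_prop : Differentiable ℝ fun z : E3 => (z, s))
  have hq : DifferentiableAt ℝ (fun z => P z s + (1 / 2 : ℝ) * ‖B z s‖ ^ 2) y :=
    (hsol.pressure_differentiable s y).add (((hBs y).norm_sq ℝ).const_mul _)
  have h := hsol.momentum_eq y s
  simp only [dirDeriv, h0, map_zero, zero_sub] at h
  have e : gradient (fun z => P z s + (1 / 2 : ℝ) * ‖B z s‖ ^ 2) y =
      -(deriv (fun τ => V y τ) s
        + convection (α / (α + 1)) (1 / (α + 1)) (fun z => V z s) y) := by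
    rw [convection, ← neg_eq_iff_eq_neg, ← h]
    abel
  rw [← e]
  exact hq.hasGradientAt.hasFDerivAt

theorem magnetic_eq_zero_of_velocity_eq_zero (hα : 0 < α) (hS₀ : 0 < S₀)
    (hB : ContDiff ℝ 1 (fun p : E3 × ℝ => B p.1 p.2)) (hsol : IsSelfSimilarMHD α V B P)
    (hBper : ∀ y s, B y (s + S₀) = B y s) {R r : ℝ} (hrR : r < R)
    (hV0 : ∀ y, ‖y‖ < R → ∀ s, V y s = 0) {y : E3} (hy : ‖y‖ ≤ r) (s : ℝ) : B y s = 0 := by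
  have hBc := hB.continuous
  have h : ‖B y s‖ ^ 2 ≤ 0 := by
    refine nonpos_of_transport (h := fun y s => ‖B y s‖ ^ 2) (K := Metric.closedBall 0 r) (σ := 1)
      (by fun_prop) hS₀ (fun y s => by simp only [hBper]) (isCompact_closedBall _ _) ?_
      (by simpa using hy) s
    intro z hz τ hpos
    have hzr : ‖z‖ ≤ r := by simpa using hz
    have hzR : ‖z‖ < R := hzr.trans_lt hrR
    have hd := hsol.hasDerivAt_magnetic hB z τ
    have hV00 : (fun z => V z τ) =ᶠ[𝓝 z] fun _ => 0 := by
      filter_upwards [Metric.isOpen_ball.mem_nhds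
        (show z ∈ Metric.ball (0 : E3) R by simpa using hzR)] with x hx
      exact hV0 x (by simpa using hx) τ
    rw [hV00.fderiv_eq, hV0 z hzR τ] at hd
    -- For `0 < t < 1` the backward step multiplies `z` by `1 - t/(α+1)`, which lies in `[0, 1]`
    -- since `α > 0`. Along the forward direction `‖B‖²` has derivative `-2α/(α+1) ‖B‖²`.
    refine ⟨(1 / (α + 1)) • z + 0, ?_, _, hd.norm_sq, ?_⟩
    · have hα1 : 0 < 1 / (α + 1) := by positivity
      filter_upwards [Ioo_mem_nhdsGT (show (0 : ℝ) < 1 by norm_num)] with t ht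
      have e : z - ((1 : ℝ) * t) • ((1 / (α + 1)) • z + 0) = (1 - t * (1 / (α + 1))) • z := by
        module
      have h1 : 1 / (α + 1) ≤ 1 := by rw [div_le_one (by positivity)]; linarith
      rw [e, mem_closedBall_zero_iff, norm_smul, Real.norm_eq_abs]
      have h2 : |1 - t * (1 / (α + 1))| ≤ 1 := by
        rw [abs_le]; constructor <;> nlinarith [ht.1, ht.2]
      nlinarith [norm_nonneg z]
    · have h1 : 0 < α / (α + 1) := by positivity
      simp [inner_smul_right] at hpos ⊢
      positivity
  have := norm_nonneg (B y s)
  exact norm_eq_zero.1 (by nlinarith)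

/-- If both fields vanish on a ball, they vanish on a larger one. -/
theorem exists_larger_ball (hα : α ≠ -1) (hS₀ : 0 < S₀)
    (hV : IsC1sC2y V) (hB : ContDiff ℝ 1 (fun p : E3 × ℝ => B p.1 p.2))
    (hsol : IsSelfSimilarMHD α V B P)
    (hVper : ∀ y s, V y (s + S₀) = V y s) (hBper : ∀ y s, B y (s + S₀) = B y s) {R : ℝ}
    (hR : 0 < R) (h0 : ∀ y, ‖y‖ < R → ∀ s, V y s = 0 ∧ B y s = 0) :
    ∃ R' > R, ∀ y, ‖y‖ < R' → ∀ s, V y s = 0 ∧ B y s = 0 := by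
  have hα1 : α + 1 ≠ 0 := fun h => hα (by linarith)
  set c : ℝ := α / (α + 1) with hc
  set c' : ℝ := 1 / (α + 1) with hc'
  have hc'0 : c' ≠ 0 := by rw [hc']; positivity
  have hVc := hV.continuous_self
  have hBc := hB.continuous
  have hMc := hV.continuous_space
  have hpair : ∀ s : ℝ, Continuous fun z : E3 => (z, s) := fun s => by fun_prop
  have hVz : ∀ y, ‖y‖ ≤ R → ∀ s, V y s = 0 := fun y hy s =>
    eq_zero_of_ball (hVc.comp (hpair s) : Continuous fun z => V z s) hR (fun z hz => (h0 z hz s).1) hy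
  have hBz : ∀ y, ‖y‖ ≤ R → ∀ s, B y s = 0 := fun y hy s =>
    eq_zero_of_ball (hBc.comp (hpair s) : Continuous fun z => B z s) hR (fun z hz => (h0 z hz s).2) hy
  have hMz : ∀ y, ‖y‖ ≤ R → ∀ s, fderiv ℝ (fun z => V z s) y = 0 := fun y hy s => by
    refine eq_zero_of_ball (f := fun y => fderiv ℝ (fun z => V z s) y)
      (hMc.comp (hpair s) :) hR (fun z hz => ?_) hy
    have hV00 : (fun z => V z s) =ᶠ[𝓝 z] fun _ => 0 := by
      filter_upwards [Metric.isOpen_ball.mem_nhds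
        (show z ∈ Metric.ball (0 : E3) R by simpa using hz)] with x hx
      exact (h0 x (by simpa using hx) s).1
    rw [hV00.fderiv_eq]; simp
  have hMper : ∀ y s, fderiv ℝ (fun z => V z (s + S₀)) y = fderiv ℝ (fun z => V z s) y := by
    intro y s; simp only [hVper]
  -- Half of the lower bound for `c' ⟨y, c' y⟩` outside the ball; the other half absorbs the
  -- contribution of `V`.
  set m : ℝ := c' ^ 2 * R ^ 2 / 2 with hm
  have hm0 : 0 < m := by positivity
  obtain ⟨R₂, hR₂, hsmall⟩ := exists_radius_lt_of_periodic
    (f := fun y s => |c'| * (‖y‖ * ‖V y s‖)) (by fun_prop) hS₀ (fun y s => by simp only [hVper])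
    (R := R) (δ := m) (fun y hy s => by simpa [hVz y hy s] using hm0)
  -- The vorticity equation requires `B = 0` in a neighbourhood, so the vorticity is treated on a
  -- slightly smaller closed ball than `B`.
  obtain ⟨R₁, hR₁, hR₁₂⟩ := exists_between hR₂
  obtain ⟨L, hL0, hL⟩ := exists_bound_of_periodic
    (f := fun y s => fderiv ℝ (fun z => V z s) y) hMc hS₀ hMper R₂
  have hout : ∀ y s, R < ‖y‖ → ‖y‖ ≤ R₂ → m ≤ c' * inner ℝ y (c' • y + V y s) := by
    intro y s hy1 hy2
    have h1 := hsmall y hy2 s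
    have h2 : |c' * inner ℝ y (V y s)| ≤ |c'| * (‖y‖ * ‖V y s‖) := by
      rw [abs_mul]; gcongr; exact abs_real_inner_le_norm _ _
    have h3 := (abs_le.1 h2).1
    rw [inner_add_right, inner_smul_right, real_inner_self_eq_norm_sq]
    have h4 : c' ^ 2 * R ^ 2 ≤ c' ^ 2 * ‖y‖ ^ 2 := by gcongr
    nlinarith
  have hBzero : ∀ y, ‖y‖ ≤ R₂ → ∀ s, B y s = 0 := by
    intro y hy s
    ext i
    refine eq_zero_of_transport (f := fun i y s => B y s i) (b := fun y s => c' • y + V y s)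
      (f' := fun i y s => (fderiv ℝ (fun z => V z s) y (B y s) - c • B y s) i)
      (by intro i; fun_prop) hS₀ (fun i y s => by rw [hBper]) hm0 (C := L + |c|) (by positivity)
      (fun i y s hy => by simp [hBz y hy s]) hout (fun i y s _ _ => ?_) (fun i y s _ hy => ?_) i hy s
    · exact (EuclideanSpace.proj i : E3 →L[ℝ] ℝ).hasFDerivAt.comp_hasDerivAt (0 : ℝ)
        (hsol.hasDerivAt_magnetic hB y s)
    · calc |(fderiv ℝ (fun z => V z s) y (B y s) - c • B y s) i|
          ≤ ‖fderiv ℝ (fun z => V z s) y (B y s) - c • B y s‖ := by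
            simpa only [Real.norm_eq_abs] using
              PiLp.norm_apply_le (fderiv ℝ (fun z => V z s) y (B y s) - c • B y s) i
        _ ≤ ‖fderiv ℝ (fun z => V z s) y‖ * ‖B y s‖ + |c| * ‖B y s‖ := by
            refine (norm_sub_le _ _).trans (add_le_add (ContinuousLinearMap.le_opNorm _ _) ?_)
            rw [norm_smul, Real.norm_eq_abs]
        _ ≤ (L + |c|) * ‖B y s‖ := by
            rw [add_mul]; gcongr; exact hL y hy s
        _ ≤ _ := by gcongr; exact norm_le_sum_abs _
  have hskew : ∀ y, ‖y‖ ≤ R₁ → ∀ s, ∀ i j, skewEntry i j (fderiv ℝ (fun z => V z s) y) = 0 := by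
    intro y hy s i j
    refine eq_zero_of_transport (ι := Fin 3 × Fin 3)
      (f := fun p y s => skewEntry p.1 p.2 (fderiv ℝ (fun z => V z s) y))
      (b := fun y s => c' • y + V y s)
      (fun p => (skewEntry p.1 p.2).continuous.comp hMc) hS₀
      (fun p y s => by rw [hMper]) hm0 (C := |c + c'| + 2 * L) (by positivity)
      (fun p y s hy => by rw [hMz y hy s, map_zero])
      (fun y s hy1 hy2 => hout y s hy1 (hy2.trans hR₁₂.le))
      (fun p y s _ hy => hasDerivAt_skewEntry_fderiv hV
        (q := fun y s => P y s + (1 / 2 : ℝ) * ‖B y s‖ ^ 2) (r := R₂)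
        (fun x hx t => hsol.hasFDerivAt_totalPressure hB (hBzero x hx.le t))
        (hy.trans_lt hR₁₂) s p.1 p.2)
      (fun p y s _ hy => ?_) (i, j) hy s
    set M := fderiv ℝ (fun z => V z s) y
    have h1 : |skewEntry p.1 p.2 M| ≤ ∑ p : Fin 3 × Fin 3, |skewEntry p.1 p.2 M| :=
      Finset.single_le_sum (f := fun p : Fin 3 × Fin 3 => |skewEntry p.1 p.2 M|)
        (fun _ _ => abs_nonneg _) (Finset.mem_univ p)
    have h2 := abs_skewEntry_comp_self_le p.1 p.2 M
    have h3 : ‖M‖ ≤ L := hL y (hy.trans hR₁₂.le) s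
    rw [abs_neg, add_mul |c + c'|]
    refine (abs_add_le _ _).trans (add_le_add ?_ (h2.trans ?_))
    · rw [abs_mul]; gcongr
    · gcongr
  refine ⟨R₁, hR₁, fun y hy s => ⟨?_, hBzero y (hy.le.trans hR₁₂.le) s⟩⟩
  refine eq_zero_of_divCurl_free (hV.contDiff_space s) hR (R' := R₁) (fun y hy i j => ?_)
    (fun y _ => hsol.div_V y s) (fun y hy => (h0 y hy s).1) hy
  have := hskew y hy.le s i j
  rw [skewEntry_apply] at this
  exact sub_eq_zero.1 this

/-- If both fields vanish on a ball, they vanish identically. -/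
theorem eq_zero_of_eq_zero_on_ball (hα : α ≠ -1) (hS₀ : 0 < S₀)
    (hV : IsC1sC2y V) (hB : ContDiff ℝ 1 (fun p : E3 × ℝ => B p.1 p.2))
    (hsol : IsSelfSimilarMHD α V B P)
    (hVper : ∀ y s, V y (s + S₀) = V y s) (hBper : ∀ y s, B y (s + S₀) = B y s) {R : ℝ}
    (hR : 0 < R) (h0 : ∀ y, ‖y‖ < R → ∀ s, V y s = 0 ∧ B y s = 0) (y : E3) (s : ℝ) :
    V y s = 0 ∧ B y s = 0 := by
  set A : Set ℝ := {r | ∀ y, ‖y‖ < r → ∀ s, V y s = 0 ∧ B y s = 0} with hA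
  by_cases hbdd : BddAbove A
  · have hRA : R ∈ A := h0
    have hsup : sSup A ∈ A := fun z hz τ => by
      obtain ⟨r, hr, hzr⟩ := exists_lt_of_lt_csSup ⟨R, hRA⟩ hz
      exact hr z hzr τ
    obtain ⟨R', hR', h'⟩ := exists_larger_ball hα hS₀ hV hB hsol hVper hBper
      (hR.trans_le (le_csSup hbdd hRA)) hsup
    exact absurd (le_csSup hbdd (show R' ∈ A from h')) (not_le.2 hR')
  · obtain ⟨r, hr, hyr⟩ := not_bddAbove_iff.1 hbdd ‖y‖
    exact hr y hyr s

end

/-! ### Conclusion -/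

theorem eq_zero_of_periodic {G : Type*} [NormedAddCommGroup G] {f : ℝ → G} (hf : Continuous f)
    {T : ℝ} (hT : 0 < T) (hper : ∀ s, f (s + T) = f s) (h : ∀ s ∈ Ioo 0 T, f s = 0) (s : ℝ) :
    f s = 0 := by
  have h1 : EqOn f (fun _ => 0) (Ioo 0 T) := h
  have h2 := h1.closure hf continuous_const
  rw [closure_Ioo hT.ne] at h2
  have hp : Function.Periodic f T := hper
  obtain ⟨t, ht, he⟩ := hp.exists_mem_Ico₀ hT s
  rw [he]
  exact h2 ⟨ht.1, ht.2.le⟩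

theorem theorem1p3 (α : ℝ) (hα : α ≠ -1) (S₀ : ℝ) (hS₀ : 0 < S₀)
    (V B : E3 → ℝ → E3) (P : E3 → ℝ → ℝ)
    (hV : IsC1sC2y V) (hB : ContDiff ℝ 1 (fun p : E3 × ℝ => B p.1 p.2))
    (hsol : IsSelfSimilarMHD α V B P)
    (hVper : ∀ y s, V y (s + S₀) = V y s) (hBper : ∀ y s, B y (s + S₀) = B y s)
    (G : Set E3) (hG : IsOpen G) (h0G : (0 : E3) ∈ G)
    (hvanish :
      (0 < α ∧ ∀ y ∈ G, ∀ s ∈ Set.Ioo 0 S₀, V y s = 0) ∨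
      (((-1 < α ∧ α ≤ 0) ∨ α < -1) ∧ ∀ y ∈ G, ∀ s ∈ Set.Ioo 0 S₀, V y s = 0 ∧ B y s = 0)) :
    ∀ y s, V y s = 0 ∧ B y s = 0 := by
  obtain ⟨R, hR, hRG⟩ := Metric.isOpen_iff.1 hG 0 h0G
  have hmem : ∀ y, ‖y‖ < R → y ∈ G := fun y hy => hRG (by simpa using hy)
  have hpair : ∀ y : E3, Continuous fun s : ℝ => (y, s) := fun y => by fun_prop
  have hVc : ∀ y, Continuous fun s => V y s := fun y => hV.continuous_self.comp (hpair y)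
  have hBc : ∀ y, Continuous fun s => B y s := fun y => hB.continuous.comp (hpair y)
  rcases hvanish with ⟨hα0, h⟩ | ⟨-, h⟩
  · have hV0 : ∀ y, ‖y‖ < R → ∀ s, V y s = 0 := fun y hy =>
      eq_zero_of_periodic (hVc y) hS₀ (hVper y) (h y (hmem y hy))
    -- The radius is halved because the argument for `B` needs a closed ball inside the open one
    -- where `V` vanishes.
    exact eq_zero_of_eq_zero_on_ball hα hS₀ hV hB hsol hVper hBper (half_pos hR) fun y hy s =>
      ⟨hV0 y (hy.trans (half_lt_self hR)) s, magnetic_eq_zero_of_velocity_eq_zero hα0 hS₀ hB hsol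
        hBper (half_lt_self hR) hV0 hy.le s⟩
  · exact eq_zero_of_eq_zero_on_ball hα hS₀ hV hB hsol hVper hBper hR fun y hy s =>
      ⟨eq_zero_of_periodic (hVc y) hS₀ (hVper y) (fun s hs => (h y (hmem y hy) s hs).1) s,
        eq_zero_of_periodic (hBc y) hS₀ (hBper y) (fun s hs => (h y (hmem y hy) s hs).2) s⟩
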